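/- Fix $L>0$, a positive integer $N$ and $\alpha\in[0,2\pi)$. For $\varepsilon>0$ and $u=(u_1,u_2)\in H^1((0,1);\mathbb R^2)$, with $\mathbb R^2$ identified with $\mathbb C$, let $$E_\varepsilon(u)=\int_0^1 \frac{\varepsilon}{2}|u'|^2+\frac{1}{4\varepsilon}(|u|^2-1)^2+\frac L2\,(u_1u_2'-u_2u_1'-2\pi N)^2\,dx,$$ $$\mathcal A_\alpha=\{u\in H^1((0,1);\mathbb R^2): u(0)=1,\ u(1)=e^{i\alpha}\}.$$ For each $\varepsilon>0$ let $u_\varepsilon$ be a global minimizer of $E_\varepsilon$ in $\mathcal A_\alpha$, and let $\varepsilon_j\to0$ be any sequence of positive numbers. Then, along a subsequence (not relabelled), $u_{\varepsilon_j}\to u$ in $L^2((0,1);\mathbb R^2)$, where: 1. if $L\alpha^2>\frac{4\sqrt2}{3}$ and $L(2\pi-\alpha)^2>\frac{4\sqrt2}{3}$, then for some $x_0\in[0,1]$ $$u(x)=e^{i2\pi Nx}\ \text{ if } x<x_0,\qquad u(x)=e^{i(2\pi Nx+\alpha)}\ \text{ if } x>x_0;$$ 2. if $L\alpha^2<\frac{4\sqrt2}{3}$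 and $\alpha\in[0,\pi)$, then $u(x)=e^{i(2\pi N+\alpha)x}$; 3. if $L(2\pi-\alpha)^2<\frac{4\sqrt2}{3}$ and $\alpha\in(\pi,2\pi)$, then $u(x)=e^{i(2\pi(N-1)+\alpha)x}$; 4. if $\alpha=\pi$ and $L\pi^2<\frac{4\sqrt2}{3}$, then $u(x)=e^{i(2\pi N+\pi)x}$ or $u(x)=e^{i(2\pi(N-1)+\pi)x}$. -/

import Mathlib

open MeasureTheory Set Filter Topology

noncomputable section

/-- `u ∈ H¹((0,1); ℝ²)`, with `ℝ²` identified with `ℂ`: `u` is (the continuous representative)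
absolutely continuous on `[0,1]` with derivative in `L²(0,1)`. Only the values on `[0,1]` matter. -/
def IsH1 (u : ℝ → ℂ) : Prop :=
  AbsolutelyContinuousOnInterval u 0 1 ∧ MemLp (deriv u) 2 (volume.restrict (Ioo (0 : ℝ) 1))

/-- The twist `𝒯(u) = u₁ u₂' - u₂ u₁'`. -/
def twist (u : ℝ → ℂ) (x : ℝ) : ℝ :=
  (u x).re * (deriv u x).im - (u x).im * (deriv u x).re

/-- The energy
`E_ε(u) = ∫₀¹ (ε/2)|u'|² + (1/(4ε))(|u|² - 1)² + (L/2)(u₁u₂' - u₂u₁' - 2πN)² dx`. -/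
def energy (L : ℝ) (N : ℕ) (ε : ℝ) (u : ℝ → ℂ) : ℝ :=
  ∫ x in (0 : ℝ)..1,
    (ε / 2 * ‖deriv u x‖ ^ 2 + 1 / (4 * ε) * (‖u x‖ ^ 2 - 1) ^ 2
      + L / 2 * (twist u x - 2 * Real.pi * N) ^ 2)

/-- The admissible class `𝒜_α`: `H¹` maps with `u(0) = 1` and `u(1) = e^{iα}`. -/
def Admissible (α : ℝ) (u : ℝ → ℂ) : Prop :=
  IsH1 u ∧ u 0 = 1 ∧ u 1 = Complex.exp (Complex.I * α)

/-- `u` is a global minimizer of `E_ε` within `𝒜_α`. -/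
def IsGlobalMinimizer (L : ℝ) (N : ℕ) (α ε : ℝ) (u : ℝ → ℂ) : Prop :=
  Admissible α u ∧ ∀ v : ℝ → ℂ, Admissible α v → energy L N ε u ≤ energy L N ε v

/-- Convergence in `L²((0,1); ℝ²)` of a sequence of maps. -/
def TendstoL2 (w : ℕ → ℝ → ℂ) (u : ℝ → ℂ) : Prop :=
  Tendsto (fun j => eLpNorm (fun x => w j x - u x) 2 (volume.restrict (Ioo (0 : ℝ) 1)))
    atTop (𝓝 0)

/-- The map `x ↦ e^{icx}` of constant twist `c`. -/
def constTwist (c : ℝ) (x : ℝ) : ℂ := Complex.exp (Complex.I * (c * x : ℝ))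

/-- The one-jump map: `e^{i2πNx}` for `x < x₀` and `e^{i(2πNx+α)}` for `x > x₀`. -/
def oneJump (N : ℕ) (α x₀ : ℝ) (x : ℝ) : ℂ :=
  if x < x₀ then Complex.exp (Complex.I * (2 * Real.pi * N * x : ℝ))
  else Complex.exp (Complex.I * (2 * Real.pi * N * x + α : ℝ))

end

/-! The competition is between a vortex and an elastic twist. Put G(r) = r - r³/3, a primitive of 1
- r². By AM–GM the first two energy terms dominate the variation of G(|u|) divided by √2
(`integral_potential_mul_deriv_le`, `abs_modulus_sub_le`). Since |u| = 1 at both ends, a dip of |u|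
to 0 costs at least 2√2/3, and a tanh profile attains this in the limit
(`energy_jumpCompetitor_le`). At a zero the phase may jump freely, so the twist can be 2πN
elsewhere. Without a zero the total twist is nearly 2πk + α for an integer k, which costs about
(L/2)(2π(k-N) + α)²; the cheapest choices are k = N and k = N - 1, with costs Lα²/2 and L(2π-α)²/2.
Comparison with 2√2/3 gives the threshold 4√2/3.

The link between twist and phase is quantitative: the phase derivative is T/|u|², which differs from
the twist T by an error controlled by ∫ |T| ||u|² - 1| = O(√ε) when |u| is bounded below
(`exists_phase`, `integral_twist_mul_potential_le`).

Below the threshold the energy is too small for a full dip, so |u| stays away from 0; the winding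
number is then forced, and equality in the twist energy forces T to be nearly constant in L²
(`exists_close_constTwist`). Above both thresholds |u| must nearly vanish
(`eventually_exists_norm_lt`). That dip uses up all the available energy, so the twist tends to 2πN
in L² and no second dip is possible; transporting the phase from each endpoint up to the dip gives
the one-jump limit (`exists_tendsto_oneJump`). -/

/-! ### Absolutely continuous complex maps and preliminary integral estimates. -/

/-- Absolute continuity passes to a map whose increments are dominated by those of an absolutely
continuous map. -/
theorem AbsolutelyContinuousOnInterval.of_dist_le {X Y : Type*} [PseudoMetricSpace X]
    [PseudoMetricSpace Y] {f : ℝ → X} {g : ℝ → Y} {a b C : ℝ}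
    (hg : AbsolutelyContinuousOnInterval g a b)
    (h : ∀ s ∈ uIcc a b, ∀ t ∈ uIcc a b, dist (f s) (f t) ≤ C * dist (g s) (g t)) :
    AbsolutelyContinuousOnInterval f a b := by
  have hg' : Tendsto (fun E : ℕ × (ℕ → ℝ × ℝ) ↦
      C * ∑ i ∈ Finset.range E.1, dist (g (E.2 i).1) (g (E.2 i).2))
      (AbsolutelyContinuousOnInterval.totalLengthFilter ⊓
        𝓟 (AbsolutelyContinuousOnInterval.disjWithin a b)) (𝓝 0) := by
    simpa using Tendsto.const_mul C hg
  refine squeeze_zero' (Eventually.of_forall fun E => Finset.sum_nonneg fun i _ => dist_nonneg)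
    ?_ hg'
  have hmem : ∀ᶠ E in (AbsolutelyContinuousOnInterval.totalLengthFilter ⊓
      𝓟 (AbsolutelyContinuousOnInterval.disjWithin a b)),
      E ∈ AbsolutelyContinuousOnInterval.disjWithin a b :=
    eventually_inf_principal.2 (Eventually.of_forall fun _ h => h)
  filter_upwards [hmem] with E hE
  rw [Finset.mul_sum]
  refine Finset.sum_le_sum fun i hi => ?_
  have := hE.1 i hi
  exact h _ this.1 _ this.2

theorem AbsolutelyContinuousOnInterval.lipschitzOnWith_comp {X Y : Type*} [PseudoMetricSpace X]
    [PseudoMetricSpace Y] {f : ℝ → X} {φ : X → Y} {a b : ℝ} {K : NNReal} {s : Set X}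
    (hf : AbsolutelyContinuousOnInterval f a b) (hφ : LipschitzOnWith K φ s)
    (hs : ∀ t ∈ uIcc a b, f t ∈ s) :
    AbsolutelyContinuousOnInterval (fun t => φ (f t)) a b :=
  hf.of_dist_le fun x hx y hy => hφ.dist_le_mul _ (hs x hx) _ (hs y hy)

theorem AbsolutelyContinuousOnInterval.norm {f : ℝ → ℂ} {a b : ℝ}
    (hf : AbsolutelyContinuousOnInterval f a b) :
    AbsolutelyContinuousOnInterval (fun t => ‖f t‖) a b :=
  hf.lipschitzOnWith_comp (s := univ) lipschitzWith_one_norm.lipschitzOnWith fun _ _ => mem_univ _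

/-- The increments are dominated by those of the real primitive of ‖g‖. -/
theorem IntervalIntegrable.absolutelyContinuousOnInterval_integral_complex {g : ℝ → ℂ} {a b : ℝ}
    (hg : IntervalIntegrable g volume a b) :
    AbsolutelyContinuousOnInterval (fun x => ∫ t in a..x, g t) a b := by
  have h := hg.norm.absolutelyContinuousOnInterval_intervalIntegral (c := a) left_mem_uIcc
  have hsub : ∀ s ∈ uIcc a b, ∀ t ∈ uIcc a b, uIcc s t ⊆ uIcc a b := fun s hs t ht =>
    uIcc_subset_uIcc hs ht
  refine h.of_dist_le (C := 1) fun s hs t ht => ?_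
  have h1 := hg.mono_set (hsub a left_mem_uIcc s hs)
  have h2 := hg.mono_set (hsub a left_mem_uIcc t ht)
  rw [one_mul, dist_eq_norm, dist_eq_norm, intervalIntegral.integral_interval_sub_left h1 h2,
    intervalIntegral.integral_interval_sub_left h1.norm h2.norm]
  exact intervalIntegral.norm_integral_le_abs_integral_norm

theorem AbsolutelyContinuousOnInterval.cexp {f : ℝ → ℂ} {a b : ℝ}
    (hf : AbsolutelyContinuousOnInterval f a b) :
    AbsolutelyContinuousOnInterval (fun t => Complex.exp (f t)) a b := by
  obtain ⟨C, hC⟩ := hf.exists_bound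
  have hc : ContDiffOn ℝ 1 Complex.exp (Metric.closedBall 0 C) :=
    Complex.contDiff_exp.contDiffOn
  obtain ⟨K, hK⟩ := hc.exists_lipschitzOnWith (by decide) (convex_closedBall _ _)
    (isCompact_closedBall _ _)
  exact hf.lipschitzOnWith_comp hK fun t ht => by simpa using hC t ht

theorem AbsolutelyContinuousOnInterval.ae_differentiableAt_complex {f : ℝ → ℂ} {a b : ℝ}
    (hf : AbsolutelyContinuousOnInterval f a b) :
    ∀ᵐ x : ℝ, x ∈ uIcc a b → DifferentiableAt ℝ f x :=
  hf.boundedVariationOn.ae_differentiableAt_of_mem_uIcc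

/-- A nowhere vanishing absolutely continuous map is the exponential of the integral of its
logarithmic derivative. -/
theorem AbsolutelyContinuousOnInterval.eq_mul_cexp_integral {u : ℝ → ℂ} {a b : ℝ}
    (hu : AbsolutelyContinuousOnInterval u a b) (hd : IntervalIntegrable (deriv u) volume a b)
    (h0 : ∀ t ∈ uIcc a b, u t ≠ 0) :
    IntervalIntegrable (fun t => deriv u t / u t) volume a b ∧
      u b = u a * Complex.exp (∫ t in a..b, deriv u t / u t) := by
  have hg : IntervalIntegrable (fun t => deriv u t / u t) volume a b := by
    simp_rw [div_eq_mul_inv]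
    exact hd.mul_continuousOn (hu.continuousOn.inv₀ h0)
  refine ⟨hg, ?_⟩
  have hH := hg.absolutelyContinuousOnInterval_integral_complex
  -- The product u · exp(-∫ u'/u) is absolutely continuous with derivative 0 almost everywhere,
  -- hence constant. This avoids choosing a branch of the logarithm.
  have hF := hu.smul (hH.fun_neg.cexp)
  have hF0 : ∀ᵐ x, x ∈ uIcc a b → HasDerivAt (u • fun t =>
      Complex.exp (-∫ s in a..t, deriv u s / u s)) 0 x := by
    filter_upwards [hu.ae_differentiableAt_complex, hg.ae_hasDerivAt_integral] with x h1 h2 hx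
    have h3 := (h1 hx).hasDerivAt
    have h4 := (h2 hx a left_mem_uIcc).neg.cexp
    have h5 := h3.mul h4
    have h6 := h0 x hx
    refine HasDerivAt.congr_deriv (f := u • fun t =>
      Complex.exp (-∫ s in a..t, deriv u s / u s)) h5 ?_
    field_simp
    simp
  obtain ⟨C, hC⟩ := hF.const_of_ae_hasDerivAt_zero hF0
  have ha := hC a left_mem_uIcc
  have hb := hC b right_mem_uIcc
  simp only [Pi.smul_apply', smul_eq_mul, intervalIntegral.integral_same, neg_zero,
    Complex.exp_zero, mul_one] at ha hb
  rw [ha, ← hb, mul_assoc, ← Complex.exp_add]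
  simp

/-- Reverse triangle inequality for the difference quotients, then passage to the limit. -/
theorem abs_deriv_norm_le {u : ℝ → ℂ} {x : ℝ} (hu : DifferentiableAt ℝ u x)
    (hn : DifferentiableAt ℝ (fun t => ‖u t‖) x) : |deriv (fun t => ‖u t‖) x| ≤ ‖deriv u x‖ := by
  have h1 := hu.hasDerivAt.tendsto_slope.norm
  have h2 := hn.hasDerivAt.tendsto_slope.norm
  refine le_of_tendsto_of_tendsto h2 h1 (Eventually.of_forall fun y => ?_)
  simp only [slope, vsub_eq_sub, norm_smul]
  gcongr
  exact abs_norm_sub_norm_le _ _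

theorem intervalIntegral_le_of_subinterval {f : ℝ → ℝ} (hf : IntervalIntegrable f volume 0 1)
    (h0 : ∀ t, 0 ≤ f t) {x y : ℝ} (hx : 0 ≤ x) (hxy : x ≤ y) (hy : y ≤ 1) :
    ∫ t in x..y, f t ≤ ∫ t in (0 : ℝ)..1, f t :=
  intervalIntegral.integral_mono_interval hx hxy hy (Eventually.of_forall h0) hf

theorem uIcc_subset_unit {x y : ℝ} (hx : 0 ≤ x) (hxy : x ≤ y) (hy : y ≤ 1) :
    uIcc x y ⊆ uIcc (0 : ℝ) 1 := by
  rw [uIcc_of_le hxy, uIcc_of_le zero_le_one]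
  exact Icc_subset_Icc hx hy

/-- The `L¹` norm on the unit interval is bounded by the `L²` norm. -/
theorem sq_integral_le {f : ℝ → ℝ} (hf : IntervalIntegrable f volume 0 1)
    (hf2 : IntervalIntegrable (fun t => f t ^ 2) volume 0 1) :
    (∫ t in (0 : ℝ)..1, f t) ^ 2 ≤ ∫ t in (0 : ℝ)..1, f t ^ 2 := by
  set m := ∫ t in (0 : ℝ)..1, f t with hm
  -- The variance of f is nonnegative.
  have h : 0 ≤ ∫ t in (0 : ℝ)..1, (f t - m) ^ 2 :=
    intervalIntegral.integral_nonneg zero_le_one fun _ _ => sq_nonneg _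
  have e : ∫ t in (0 : ℝ)..1, (f t - m) ^ 2 = (∫ t in (0 : ℝ)..1, f t ^ 2) - 2 * m * m + m ^ 2 := by
    have : ∀ t, (f t - m) ^ 2 = f t ^ 2 - 2 * m * f t + m ^ 2 := fun t => by ring
    simp_rw [this]
    rw [intervalIntegral.integral_add (hf2.sub (hf.const_mul _)) intervalIntegrable_const,
      intervalIntegral.integral_sub hf2 (hf.const_mul _), intervalIntegral.integral_const_mul,
      ← hm]
    simp
  nlinarith

/-! ### Energy terms of H¹ maps, the Modica–Mortola inequality, and the phase. -/

namespace IsH1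

variable {u : ℝ → ℂ}

theorem continuousOn (hu : IsH1 u) : ContinuousOn u (uIcc 0 1) := hu.1.continuousOn

theorem memLp_deriv (hu : IsH1 u) : MemLp (deriv u) 2 (volume.restrict (Ioc (0 : ℝ) 1)) := by
  rw [← restrict_Ioo_eq_restrict_Ioc]
  exact hu.2

theorem intervalIntegrable_deriv (hu : IsH1 u) : IntervalIntegrable (deriv u) volume 0 1 := by
  rw [intervalIntegrable_iff_integrableOn_Ioc_of_le zero_le_one]
  exact hu.memLp_deriv.integrable (by norm_num)

theorem intervalIntegrable_norm_deriv_sq (hu : IsH1 u) :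
    IntervalIntegrable (fun t => ‖deriv u t‖ ^ 2) volume 0 1 := by
  rw [intervalIntegrable_iff_integrableOn_Ioc_of_le zero_le_one]
  exact hu.memLp_deriv.integrable_norm_pow (by norm_num)

theorem continuousOn_potential (hu : IsH1 u) :
    ContinuousOn (fun t => ‖u t‖ ^ 2 - 1) (uIcc 0 1) :=
  (hu.continuousOn.norm.pow 2).sub continuousOn_const

theorem intervalIntegrable_potential_sq (hu : IsH1 u) :
    IntervalIntegrable (fun t => (‖u t‖ ^ 2 - 1) ^ 2) volume 0 1 :=
  (hu.continuousOn_potential.pow 2).intervalIntegrable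

theorem intervalIntegrable_twist (hu : IsH1 u) : IntervalIntegrable (twist u) volume 0 1 := by
  have h : IntervalIntegrable (fun t => starRingEnd ℂ (u t) * deriv u t) volume 0 1 :=
    hu.intervalIntegrable_deriv.continuousOn_mul
      (Complex.continuous_conj.comp_continuousOn hu.continuousOn)
  rw [intervalIntegrable_iff] at h ⊢
  refine (Integrable.im h).congr (Eventually.of_forall fun t => ?_)
  simp [twist]
  ring

/-- Lagrange's identity: the difference of the two sides is the square of the real inner product of
u and u'. -/
theorem twist_sq_le (u : ℝ → ℂ) (t : ℝ) : twist u t ^ 2 ≤ ‖u t‖ ^ 2 * ‖deriv u t‖ ^ 2 := by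
  rw [Complex.sq_norm, Complex.sq_norm, Complex.normSq_apply, Complex.normSq_apply, twist]
  nlinarith [sq_nonneg ((u t).re * (deriv u t).re + (u t).im * (deriv u t).im)]

theorem intervalIntegrable_twist_sq (hu : IsH1 u) :
    IntervalIntegrable (fun t => twist u t ^ 2) volume 0 1 := by
  have h := hu.intervalIntegrable_norm_deriv_sq.continuousOn_mul (hu.continuousOn.norm.pow 2)
  refine h.mono_fun ?_ (Eventually.of_forall fun t => ?_)
  · exact (intervalIntegrable_iff.1 hu.intervalIntegrable_twist).aestronglyMeasurable.pow 2
  · simp only [Pi.pow_apply]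
    rw [Real.norm_of_nonneg (sq_nonneg _), Real.norm_of_nonneg (by positivity)]
    exact twist_sq_le u t

theorem intervalIntegrable_twist_sub_sq (hu : IsH1 u) (κ : ℝ) :
    IntervalIntegrable (fun t => (twist u t - κ) ^ 2) volume 0 1 := by
  have : ∀ t, (twist u t - κ) ^ 2 = twist u t ^ 2 - 2 * κ * twist u t + κ ^ 2 := fun t => by ring
  simp_rw [this]
  exact (hu.intervalIntegrable_twist_sq.sub (hu.intervalIntegrable_twist.const_mul _)).add
    intervalIntegrable_const

theorem intervalIntegrable_abs_twist_sub (hu : IsH1 u) (κ : ℝ) :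
    IntervalIntegrable (fun t => |twist u t - κ|) volume 0 1 :=
  (hu.intervalIntegrable_twist.sub intervalIntegrable_const).abs

theorem intervalIntegrable_twist_mul_potential (hu : IsH1 u) :
    IntervalIntegrable (fun t => |twist u t| * |‖u t‖ ^ 2 - 1|) volume 0 1 :=
  hu.intervalIntegrable_twist.abs.mul_continuousOn hu.continuousOn_potential.abs

theorem intervalIntegrable_potential_mul_deriv (hu : IsH1 u) :
    IntervalIntegrable (fun t => |‖u t‖ ^ 2 - 1| * ‖deriv u t‖) volume 0 1 :=
  hu.intervalIntegrable_deriv.norm.continuousOn_mul hu.continuousOn_potential.abs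

theorem energy_eq (hu : IsH1 u) (L : ℝ) (N : ℕ) (ε : ℝ) :
    energy L N ε u = ε / 2 * (∫ t in (0 : ℝ)..1, ‖deriv u t‖ ^ 2)
      + 1 / (4 * ε) * (∫ t in (0 : ℝ)..1, (‖u t‖ ^ 2 - 1) ^ 2)
      + L / 2 * ∫ t in (0 : ℝ)..1, (twist u t - 2 * Real.pi * N) ^ 2 := by
  rw [energy, intervalIntegral.integral_add, intervalIntegral.integral_add,
    intervalIntegral.integral_const_mul, intervalIntegral.integral_const_mul,
    intervalIntegral.integral_const_mul]
  · exact hu.intervalIntegrable_norm_deriv_sq.const_mul _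
  · exact hu.intervalIntegrable_potential_sq.const_mul _
  · exact (hu.intervalIntegrable_norm_deriv_sq.const_mul _).add
      (hu.intervalIntegrable_potential_sq.const_mul _)
  · exact (hu.intervalIntegrable_twist_sub_sq _).const_mul _

/-- Modica–Mortola: oscillation of the modulus is paid for in energy. -/
theorem integral_potential_mul_deriv_le (hu : IsH1 u) (L : ℝ) (N : ℕ) {ε : ℝ} (hε : 0 < ε) :
    ∫ t in (0 : ℝ)..1, |‖u t‖ ^ 2 - 1| * ‖deriv u t‖ ≤
      Real.sqrt 2 * (energy L N ε u
        - L / 2 * ∫ t in (0 : ℝ)..1, (twist u t - 2 * Real.pi * N) ^ 2) := by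
  rw [hu.energy_eq L N ε, add_sub_cancel_right, ← intervalIntegral.integral_const_mul,
    ← intervalIntegral.integral_const_mul, ← intervalIntegral.integral_add
      (hu.intervalIntegrable_norm_deriv_sq.const_mul _)
      (hu.intervalIntegrable_potential_sq.const_mul _), ← intervalIntegral.integral_const_mul]
  refine intervalIntegral.integral_mono_on zero_le_one hu.intervalIntegrable_potential_mul_deriv
    (((hu.intervalIntegrable_norm_deriv_sq.const_mul _).add
      (hu.intervalIntegrable_potential_sq.const_mul _)).const_mul _) fun t _ => ?_
  rw [← sq_abs (‖u t‖ ^ 2 - 1)]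
  set p := |‖u t‖ ^ 2 - 1|
  set d := ‖deriv u t‖
  have h2 : Real.sqrt 2 ^ 2 = 2 := Real.sq_sqrt (by norm_num)
  set s := Real.sqrt 2
  have hs : 0 < s := Real.sqrt_pos.2 (by norm_num)
  -- Completed square. Equality p = √2 ε d is the equation of the tanh profile of width √2 ε, which
  -- is used for the competitor.
  have key : s * (ε / 2 * d ^ 2 + 1 / (4 * ε) * p ^ 2) - p * d =
      s / (4 * ε) * (p - s * ε * d) ^ 2 := by
    field_simp
    linear_combination 2 * (-s * ε * d ^ 2 + 2 * p * d) * ε * h2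
  have : 0 ≤ s / (4 * ε) * (p - s * ε * d) ^ 2 := by positivity
  linarith

/-- The function r - r³/3 has derivative 1 - r², and the modulus varies no faster than u itself. -/
theorem abs_modulus_sub_le (hu : IsH1 u) {x y : ℝ} (hx : 0 ≤ x) (hxy : x ≤ y) (hy : y ≤ 1) :
    |(‖u y‖ - ‖u y‖ ^ 3 / 3) - (‖u x‖ - ‖u x‖ ^ 3 / 3)| ≤
      ∫ t in x..y, |‖u t‖ ^ 2 - 1| * ‖deriv u t‖ := by
  have hsub := uIcc_subset_unit hx hxy hy
  have hu1 := hu.1.mono hsub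
  have hn := hu1.norm
  have hG : AbsolutelyContinuousOnInterval
      (fun t => ‖u t‖ - 1 / 3 * (‖u t‖ * (‖u t‖ * ‖u t‖))) x y :=
    hn.fun_sub ((hn.fun_mul (hn.fun_mul hn)).const_mul _)
  have e := hG.integral_deriv_eq_sub
  have e' : (‖u y‖ - ‖u y‖ ^ 3 / 3) - (‖u x‖ - ‖u x‖ ^ 3 / 3) =
      ∫ t in x..y, deriv (fun t => ‖u t‖ - 1 / 3 * (‖u t‖ * (‖u t‖ * ‖u t‖))) t := by
    rw [e]; ring
  rw [e', ← Real.norm_eq_abs]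
  refine intervalIntegral.norm_integral_le_of_norm_le hxy ?_
    (hu.intervalIntegrable_potential_mul_deriv.mono_set hsub)
  filter_upwards [hu1.ae_differentiableAt_complex, hn.ae_differentiableAt] with t h1 h2 ht
  have ht' : t ∈ uIcc x y := by rw [uIcc_of_le hxy]; exact Ioc_subset_Icc_self ht
  have d := (h2 ht').hasDerivAt
  have d2 := d.sub ((d.mul (d.mul d)).const_mul (1 / 3))
  have d3 : deriv (fun t => ‖u t‖ - 1 / 3 * (‖u t‖ * (‖u t‖ * ‖u t‖))) t =
      -(‖u t‖ ^ 2 - 1) * deriv (fun t => ‖u t‖) t := by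
    refine (HasDerivAt.deriv d2).trans ?_
    simp only [Pi.mul_apply]
    ring
  rw [d3, Real.norm_eq_abs, abs_mul, abs_neg]
  gcongr
  exact abs_deriv_norm_le (h1 ht') (h2 ht')

/-- The phase increment across an interval on which the modulus stays above `c`. -/
theorem exists_phase (hu : IsH1 u) {c x y : ℝ} (hc : 0 < c) (hx : 0 ≤ x) (hxy : x ≤ y)
    (hy : y ≤ 1) (hcu : ∀ t ∈ Icc x y, c ≤ ‖u t‖) :
    ∃ θ : ℝ, u y / ‖u y‖ = u x / ‖u x‖ * Complex.exp (Complex.I * θ) ∧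
      |θ - ∫ t in x..y, twist u t| ≤
        1 / c ^ 2 * ∫ t in (0 : ℝ)..1, |twist u t| * |‖u t‖ ^ 2 - 1| := by
  have hsub := uIcc_subset_unit hx hxy hy
  have hpos : ∀ t ∈ uIcc x y, u t ≠ 0 := fun t ht h => by
    rw [uIcc_of_le hxy] at ht
    have := hcu t ht
    rw [h, norm_zero] at this
    linarith
  obtain ⟨hint, heq⟩ := (hu.1.mono hsub).eq_mul_cexp_integral
    (hu.intervalIntegrable_deriv.mono_set hsub) hpos
  set z := ∫ t in x..y, deriv u t / u t with hz
  -- The real part of the integrated logarithmic derivative only changes the modulus; the imaginary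
  -- part is the phase increment, with density T/|u|².
  have him : z.im = ∫ t in x..y, twist u t / ‖u t‖ ^ 2 := by
    have h := Complex.imCLM.intervalIntegral_comp_comm hint
    simp only [Complex.imCLM_apply] at h
    rw [hz, ← h]
    refine intervalIntegral.integral_congr fun t ht => ?_
    have := hpos t ht
    simp only [Complex.div_im, Complex.sq_norm, twist]
    ring
  refine ⟨z.im, ?_, ?_⟩
  · have hux := hpos x left_mem_uIcc
    have : (‖u x‖ : ℂ) ≠ 0 := by simpa using hux
    rw [heq, norm_mul, Complex.norm_exp]
    push_cast
    have hexp : Complex.exp z = Complex.exp z.re * Complex.exp (Complex.I * z.im) := by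
      rw [← Complex.exp_add]
      congr 1
      conv_lhs => rw [← Complex.re_add_im z]
      ring
    rw [hexp]
    have : Complex.exp z.re ≠ 0 := Complex.exp_ne_zero _
    field_simp
  · have hT := hu.intervalIntegrable_twist.mono_set hsub
    have hTu : IntervalIntegrable (fun t => twist u t / ‖u t‖ ^ 2) volume x y := by
      simp_rw [div_eq_mul_inv]
      exact hT.mul_continuousOn (((hu.continuousOn.mono hsub).norm.pow 2).inv₀ fun t ht => by
        have := hpos t ht
        simpa using this)
    rw [him, ← intervalIntegral.integral_sub hTu hT]
    have hP := hu.intervalIntegrable_twist_mul_potential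
    calc |∫ t in x..y, (twist u t / ‖u t‖ ^ 2 - twist u t)|
        ≤ ∫ t in x..y, 1 / c ^ 2 * (|twist u t| * |‖u t‖ ^ 2 - 1|) := by
          rw [← Real.norm_eq_abs]
          refine intervalIntegral.norm_integral_le_of_norm_le hxy
            (Eventually.of_forall fun t ht => ?_) ((hP.mono_set hsub).const_mul _)
          have h1 : c ≤ ‖u t‖ := hcu t (Ioc_subset_Icc_self ht)
          have h2 : 0 < ‖u t‖ := hc.trans_le h1
          have : twist u t / ‖u t‖ ^ 2 - twist u t =
              -(1 / ‖u t‖ ^ 2 * (twist u t * (‖u t‖ ^ 2 - 1))) := by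
            field_simp
            ring
          rw [this, Real.norm_eq_abs, abs_neg, abs_mul, abs_mul,
            abs_of_nonneg (by positivity : 0 ≤ 1 / ‖u t‖ ^ 2)]
          gcongr
      _ ≤ 1 / c ^ 2 * ∫ t in (0 : ℝ)..1, |twist u t| * |‖u t‖ ^ 2 - 1| := by
          rw [intervalIntegral.integral_const_mul]
          gcongr
          exact intervalIntegral_le_of_subinterval hP (fun t => by positivity) hx hxy hy

theorem norm_cexp_I_sub_le (a b : ℝ) :
    ‖Complex.exp (Complex.I * a) - Complex.exp (Complex.I * b)‖ ≤ |a - b| := by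
  have : Complex.exp (Complex.I * a) - Complex.exp (Complex.I * b) =
      Complex.exp (Complex.I * b) * (Complex.exp (Complex.I * (a - b : ℝ)) - 1) := by
    rw [mul_sub, ← Complex.exp_add, mul_one]
    congr 2
    push_cast
    ring
  rw [this, norm_mul, Complex.norm_exp_I_mul_ofReal, one_mul]
  exact Real.norm_exp_I_mul_ofReal_sub_one_le

/-- Away from zeros, the phase is close to the one of constant twist `κ`. -/
theorem norm_direction_sub_le (hu : IsH1 u) {c x y : ℝ} (κ : ℝ) (hc : 0 < c) (hx : 0 ≤ x)
    (hxy : x ≤ y) (hy : y ≤ 1) (hcu : ∀ t ∈ Icc x y, c ≤ ‖u t‖) :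
    ‖u y / ‖u y‖ - u x / ‖u x‖ * Complex.exp (Complex.I * (κ * (y - x) : ℝ))‖ ≤
      1 / c ^ 2 * (∫ t in (0 : ℝ)..1, |twist u t| * |‖u t‖ ^ 2 - 1|)
        + ∫ t in (0 : ℝ)..1, |twist u t - κ| := by
  obtain ⟨θ, h1, h2⟩ := hu.exists_phase hc hx hxy hy hcu
  have hux : u x ≠ 0 := fun h => by
    have := hcu x (left_mem_Icc.2 hxy)
    rw [h, norm_zero] at this
    linarith
  have hT := hu.intervalIntegrable_twist.mono_set (uIcc_subset_unit hx hxy hy)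
  have h3 : |(∫ t in x..y, twist u t) - κ * (y - x)| ≤ ∫ t in (0 : ℝ)..1, |twist u t - κ| := by
    have : (∫ t in x..y, twist u t) - κ * (y - x) = ∫ t in x..y, (twist u t - κ) := by
      rw [intervalIntegral.integral_sub hT intervalIntegrable_const]
      simp [mul_comm]
    rw [this]
    exact (intervalIntegral.abs_integral_le_integral_abs hxy).trans
      (intervalIntegral_le_of_subinterval (hu.intervalIntegrable_abs_twist_sub κ)
        (fun _ => abs_nonneg _) hx hxy hy)
  rw [h1, ← mul_sub, norm_mul]
  have h4 : ‖u x / ‖u x‖‖ = 1 := by simp [hux]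
  rw [h4, one_mul]
  refine (norm_cexp_I_sub_le _ _).trans ?_
  have := abs_sub_le θ (∫ t in x..y, twist u t) (κ * (y - x))
  linarith

end IsH1

/-! ### Competitors of constant twist. -/

theorem twist_eq_im (u : ℝ → ℂ) (x : ℝ) : twist u x = (starRingEnd ℂ (u x) * deriv u x).im := by
  simp [twist]
  ring

theorem hasDerivAt_constTwist (c x : ℝ) :
    HasDerivAt (constTwist c) (Complex.I * c * constTwist c x) x := by
  have h1 : HasDerivAt (fun x : ℝ => Complex.I * ((c * x : ℝ) : ℂ)) (Complex.I * c) x := by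
    have := (((hasDerivAt_id x).const_mul c).ofReal_comp).const_mul Complex.I
    simpa using this
  refine h1.cexp.congr_deriv ?_
  rw [constTwist]
  ring

theorem norm_constTwist (c x : ℝ) : ‖constTwist c x‖ = 1 :=
  Complex.norm_exp_I_mul_ofReal _

theorem contDiff_constTwist (c : ℝ) : ContDiff ℝ 1 (constTwist c) := by
  unfold constTwist
  exact (contDiff_const.mul
    (Complex.ofRealCLM.contDiff.comp (contDiff_const.mul contDiff_id))).cexp

theorem admissible_constTwist {c α : ℝ} (k : ℤ) (hc : c = 2 * Real.pi * k + α) :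
    Admissible α (constTwist c) := by
  refine ⟨⟨(contDiff_constTwist c).contDiffOn.absolutelyContinuousOnInterval, ?_⟩, ?_, ?_⟩
  · refine MemLp.of_bound (measurable_deriv _).aestronglyMeasurable |c|
      (Eventually.of_forall fun x => ?_)
    rw [(hasDerivAt_constTwist c x).deriv, norm_mul, norm_constTwist]
    simp
  · simp [constTwist]
  · rw [constTwist, hc]
    push_cast
    rw [mul_one, mul_add, Complex.exp_add]
    have : Complex.I * (2 * Real.pi * k) = k * (2 * Real.pi * Complex.I) := by ring
    rw [this, Complex.exp_int_mul_two_pi_mul_I, one_mul]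

theorem energy_constTwist (L : ℝ) (N : ℕ) (ε c : ℝ) :
    energy L N ε (constTwist c) = ε / 2 * c ^ 2 + L / 2 * (c - 2 * Real.pi * N) ^ 2 := by
  have h : ∀ x, ε / 2 * ‖deriv (constTwist c) x‖ ^ 2
      + 1 / (4 * ε) * (‖constTwist c x‖ ^ 2 - 1) ^ 2
      + L / 2 * (twist (constTwist c) x - 2 * Real.pi * N) ^ 2 =
      ε / 2 * c ^ 2 + L / 2 * (c - 2 * Real.pi * N) ^ 2 := fun x => by
    have ht : twist (constTwist c) x = c := by
      rw [twist_eq_im, (hasDerivAt_constTwist c x).deriv]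
      have : starRingEnd ℂ (constTwist c x) * (Complex.I * c * constTwist c x) =
          Complex.I * c * (‖constTwist c x‖ : ℂ) ^ 2 := by
        rw [← Complex.conj_mul']
        ring
      rw [this, norm_constTwist]
      simp
    rw [ht, (hasDerivAt_constTwist c x).deriv, norm_mul, norm_constTwist]
    simp
  simp_rw [energy, h]
  simp

/-! ### The one-vortex competitor built from the tanh profile. -/

theorem hasDerivAt_tanh (x : ℝ) : HasDerivAt Real.tanh (1 - Real.tanh x ^ 2) x := by
  have hc := (Real.cosh_pos x).ne'
  have h := (Real.hasDerivAt_sinh x).div (Real.hasDerivAt_cosh x) hc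
  have e : Real.tanh = Real.sinh / Real.cosh := by
    ext t
    exact Real.tanh_eq_sinh_div_cosh t
  rw [e]
  refine h.congr_deriv ?_
  simp only [Pi.div_apply]
  field_simp

theorem contDiff_tanh : ContDiff ℝ 1 Real.tanh := by
  have e : Real.tanh = fun t => Real.sinh t / Real.cosh t := by
    ext t
    exact Real.tanh_eq_sinh_div_cosh t
  rw [e]
  exact Real.contDiff_sinh.div Real.contDiff_cosh fun t => (Real.cosh_pos t).ne'

theorem tanh_mono {x y : ℝ} (h : x ≤ y) : Real.tanh x ≤ Real.tanh y := by
  refine monotone_of_hasDerivAt_nonneg hasDerivAt_tanh (fun t => ?_) h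
  have := Real.tanh_sq_lt_one t
  simp only [Pi.zero_apply]
  linarith

theorem tendsto_tanh_atTop : Tendsto Real.tanh atTop (𝓝 1) := by
  have h : ∀ x, Real.tanh x = (1 - Real.exp (-x) ^ 2) / (1 + Real.exp (-x) ^ 2) := fun x => by
    rw [Real.tanh_eq]
    have : Real.exp x * Real.exp (-x) = 1 := by rw [← Real.exp_add]; simp
    have h1 := Real.exp_pos x
    have h2 := Real.exp_pos (-x)
    rw [div_eq_div_iff (by positivity) (by positivity)]
    linear_combination 2 * Real.exp (-x) * this
  have h0 : Tendsto (fun x => Real.exp (-x) ^ 2) atTop (𝓝 (0 ^ 2)) :=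
    Real.tendsto_exp_neg_atTop_nhds_zero.pow 2
  simp_rw [funext h]
  have := (h0.const_sub 1).div (h0.const_add 1) (by norm_num)
  rw [show (1 - 0 ^ 2) / (1 + 0 ^ 2) = (1 : ℝ) by norm_num] at this
  exact this

/-- The normalised optimal profile `tanh (a (x - 1/2)) / tanh (a / 2)` on the unit interval. -/
noncomputable def dipProfile (a x : ℝ) : ℝ := Real.tanh (a * (x - 1 / 2)) / Real.tanh (a / 2)

/-- The unimodular factor jumping at `1/2`. -/
noncomputable def jumpSign (α x : ℝ) : ℂ := if x < 1 / 2 then -1 else Complex.exp (Complex.I * α)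

theorem norm_jumpSign (α x : ℝ) : ‖jumpSign α x‖ = 1 := by
  unfold jumpSign
  split_ifs
  · simp
  · exact Complex.norm_exp_I_mul_ofReal _

/-- The profile is odd about 1/2 and runs from -1 to 1. The factor -1 on the left makes the value at
0 equal to 1, and the discontinuity of `jumpSign` is hidden at the zero of the profile. -/
noncomputable def jumpCompetitor (N : ℕ) (α a x : ℝ) : ℂ :=
  (jumpSign α x * dipProfile a x) * constTwist (2 * Real.pi * N) x

theorem tanh_pos {x : ℝ} (hx : 0 < x) : 0 < Real.tanh x := by
  rw [Real.tanh_eq_sinh_div_cosh]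
  exact div_pos (Real.sinh_pos_iff.2 hx) (Real.cosh_pos x)

section

variable {a : ℝ}

theorem hasDerivAt_dipProfile (a x : ℝ) : HasDerivAt (dipProfile a)
    (a * (1 - Real.tanh (a * (x - 1 / 2)) ^ 2) / Real.tanh (a / 2)) x := by
  have h : HasDerivAt (fun x : ℝ => a * (x - 1 / 2)) a x := by
    simpa only [mul_one, id] using ((hasDerivAt_id x).sub_const (1 / 2)).const_mul a
  have := ((hasDerivAt_tanh _).comp x h).div_const (Real.tanh (a / 2))
  refine this.congr_deriv ?_
  ring

theorem contDiff_dipProfile (a : ℝ) : ContDiff ℝ 1 (dipProfile a) := by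
  unfold dipProfile
  exact (contDiff_tanh.comp (contDiff_const.mul (contDiff_id.sub contDiff_const))).div_const _

theorem dipProfile_nonneg (ha : 0 < a) {x : ℝ} (hx : 1 / 2 ≤ x) : 0 ≤ dipProfile a x := by
  have h1 := tanh_pos (x := a / 2) (by positivity)
  have h2 : Real.tanh 0 ≤ Real.tanh (a * (x - 1 / 2)) :=
    tanh_mono (mul_nonneg ha.le (by linarith))
  rw [Real.tanh_zero] at h2
  exact div_nonneg h2 h1.le

theorem dipProfile_nonpos (ha : 0 < a) {x : ℝ} (hx : x ≤ 1 / 2) : dipProfile a x ≤ 0 := by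
  have h1 := tanh_pos (x := a / 2) (by positivity)
  have h2 : Real.tanh (a * (x - 1 / 2)) ≤ Real.tanh 0 :=
    tanh_mono (mul_nonpos_of_nonneg_of_nonpos ha.le (by linarith))
  rw [Real.tanh_zero] at h2
  exact div_nonpos_of_nonpos_of_nonneg h2 h1.le

theorem dipProfile_sq_le_one (ha : 0 < a) {x : ℝ} (hx : x ∈ Icc (0 : ℝ) 1) :
    dipProfile a x ^ 2 ≤ 1 := by
  have h1 := tanh_pos (x := a / 2) (by positivity)
  have h2 : Real.tanh (a * (x - 1 / 2)) ≤ Real.tanh (a / 2) := tanh_mono (by nlinarith [hx.2])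
  have h3 : Real.tanh (-(a / 2)) ≤ Real.tanh (a * (x - 1 / 2)) := tanh_mono (by nlinarith [hx.1])
  rw [Real.tanh_neg] at h3
  rw [dipProfile, div_pow, div_le_one (by positivity)]
  nlinarith

theorem hasDerivAt_jumpCompetitor (N : ℕ) (α a : ℝ) {x : ℝ} (hx : x ≠ 1 / 2) :
    HasDerivAt (jumpCompetitor N α a)
      (jumpSign α x * constTwist (2 * Real.pi * N) x *
        (((a * (1 - Real.tanh (a * (x - 1 / 2)) ^ 2) / Real.tanh (a / 2) : ℝ) : ℂ) +
          Complex.I * ((2 * Real.pi * N * dipProfile a x : ℝ) : ℂ))) x := by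
  have hev : ∀ᶠ y in 𝓝 x, jumpSign α y = jumpSign α x := by
    rcases lt_or_gt_of_ne hx with h | h
    · filter_upwards [eventually_lt_nhds h] with y hy
      simp only [jumpSign]
      rw [if_pos hy, if_pos h]
    · filter_upwards [eventually_gt_nhds h] with y hy
      simp only [jumpSign]
      rw [if_neg (not_lt.2 hy.le), if_neg (not_lt.2 h.le)]
  have h := ((hasDerivAt_dipProfile a x).ofReal_comp.const_mul (jumpSign α x)).mul
    (hasDerivAt_constTwist (2 * Real.pi * N) x)
  have h' : HasDerivAt (jumpCompetitor N α a) _ x := h.congr_of_eventuallyEq (by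
    filter_upwards [hev] with y hy
    simp only [jumpCompetitor, hy, Pi.mul_apply])
  refine h'.congr_deriv ?_
  push_cast
  ring

theorem norm_deriv_jumpCompetitor_sq (N : ℕ) (α a : ℝ) {x : ℝ} (hx : x ≠ 1 / 2) :
    ‖deriv (jumpCompetitor N α a) x‖ ^ 2 =
      (a * (1 - Real.tanh (a * (x - 1 / 2)) ^ 2) / Real.tanh (a / 2)) ^ 2 +
        (2 * Real.pi * N * dipProfile a x) ^ 2 := by
  rw [(hasDerivAt_jumpCompetitor N α a hx).deriv, norm_mul, norm_mul, norm_jumpSign,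
    norm_constTwist, one_mul, one_mul, Complex.sq_norm, mul_comm Complex.I,
    Complex.normSq_add_mul_I]

theorem twist_jumpCompetitor (N : ℕ) (α a : ℝ) {x : ℝ} (hx : x ≠ 1 / 2) :
    twist (jumpCompetitor N α a) x = 2 * Real.pi * N * dipProfile a x ^ 2 := by
  rw [twist_eq_im, (hasDerivAt_jumpCompetitor N α a hx).deriv, jumpCompetitor]
  set d := a * (1 - Real.tanh (a * (x - 1 / 2)) ^ 2) / Real.tanh (a / 2)
  have h1 : starRingEnd ℂ (jumpSign α x) * jumpSign α x = 1 := by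
    rw [Complex.conj_mul', norm_jumpSign]; simp
  have h2 : starRingEnd ℂ (constTwist (2 * Real.pi * N) x) * constTwist (2 * Real.pi * N) x
      = 1 := by
    rw [Complex.conj_mul', norm_constTwist]; simp
  have : starRingEnd ℂ (jumpSign α x * dipProfile a x * constTwist (2 * Real.pi * N) x) *
      (jumpSign α x * constTwist (2 * Real.pi * N) x *
        ((d : ℂ) + Complex.I * ((2 * Real.pi * N * dipProfile a x : ℝ) : ℂ))) =
      ((dipProfile a x * d : ℝ) : ℂ) +
        ((2 * Real.pi * N * dipProfile a x ^ 2 : ℝ) : ℂ) * Complex.I := by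
    simp only [map_mul, Complex.conj_ofReal]
    push_cast
    linear_combination (dipProfile a x * (d + Complex.I * (2 * Real.pi * N * dipProfile a x))) *
      (starRingEnd ℂ (constTwist (2 * Real.pi * N) x) * constTwist (2 * Real.pi * N) x * h1 + h2)
  rw [this]
  simp only [Complex.add_im, Complex.ofReal_im, Complex.mul_im, Complex.ofReal_re, Complex.I_re,
    Complex.I_im]
  ring

theorem norm_jumpCompetitor_sq (N : ℕ) (α a x : ℝ) :
    ‖jumpCompetitor N α a x‖ ^ 2 = dipProfile a x ^ 2 := by
  rw [jumpCompetitor, norm_mul, norm_mul, norm_jumpSign, norm_constTwist, one_mul, mul_one,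
    Complex.norm_real, Real.norm_eq_abs, sq_abs]

theorem admissible_jumpCompetitor (N : ℕ) (α : ℝ) (ha : 0 < a) :
    Admissible α (jumpCompetitor N α a) := by
  have ht := (tanh_pos (x := a / 2) (by positivity)).ne'
  have hne : ∀ᵐ x : ℝ, x ≠ 1 / 2 := by simp [ae_iff, measure_singleton]
  refine ⟨⟨?_, ?_⟩, ?_, ?_⟩
  · have h1 : AbsolutelyContinuousOnInterval (fun x => jumpSign α x * dipProfile a x) 0 1 := by
      refine ((contDiff_dipProfile a).contDiffOn.absolutelyContinuousOnInterval).of_dist_le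
        (C := 1) fun s _ t _ => ?_
      -- When the unimodular factor changes between s and t, the profile changes sign as well, so
      -- the sum of its moduli at s and t is exactly its increment.
      have key : ∀ s t : ℝ, s ≤ t → dist (jumpSign α s * dipProfile a s)
          (jumpSign α t * dipProfile a t) ≤ dist (dipProfile a s) (dipProfile a t) := by
        intro s t hst
        rw [dist_eq_norm, dist_eq_norm]
        by_cases h : jumpSign α s = jumpSign α t
        · rw [h, ← mul_sub, norm_mul, norm_jumpSign, one_mul, ← Complex.ofReal_sub,
            Complex.norm_real]
        · have hs : s < 1 / 2 := by
            by_contra hs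
            exact h (by simp only [jumpSign]; rw [if_neg hs, if_neg (by linarith)])
          have ht : 1 / 2 ≤ t := by
            by_contra ht
            exact h (by simp only [jumpSign]; rw [if_pos hs, if_pos (by linarith)])
          have e1 := dipProfile_nonpos ha hs.le
          have e2 := dipProfile_nonneg ha ht
          refine (norm_sub_le _ _).trans ?_
          rw [norm_mul, norm_mul, norm_jumpSign, norm_jumpSign, Complex.norm_real,
            Complex.norm_real, Real.norm_of_nonpos e1, Real.norm_of_nonneg e2,
            Real.norm_of_nonpos (by linarith)]
          linarith
      rw [one_mul]
      rcases le_total s t with h | h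
      · exact key s t h
      · rw [dist_comm, dist_comm (dipProfile a s)]
        exact key t s h
    exact h1.smul (contDiff_constTwist _).contDiffOn.absolutelyContinuousOnInterval
  · have hb : ∀ᵐ x ∂volume.restrict (Ioo (0 : ℝ) 1), ‖deriv (jumpCompetitor N α a) x‖ ≤
        a / Real.tanh (a / 2) + 2 * Real.pi * N := by
      filter_upwards [ae_restrict_of_ae hne, ae_restrict_mem measurableSet_Ioo] with x hx hmem
      refine abs_le_of_sq_le_sq' ?_ ?_ |>.2
      · rw [norm_deriv_jumpCompetitor_sq N α a hx]
        have h1 := tanh_pos (x := a / 2) (by positivity)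
        have h2 := dipProfile_sq_le_one ha (Ioo_subset_Icc_self hmem)
        have h3 : (a * (1 - Real.tanh (a * (x - 1 / 2)) ^ 2) / Real.tanh (a / 2)) ^ 2 ≤
            (a / Real.tanh (a / 2)) ^ 2 := by
          have := Real.tanh_sq_lt_one (a * (x - 1 / 2))
          have h0 := sq_nonneg (Real.tanh (a * (x - 1 / 2)))
          refine pow_le_pow_left₀ (div_nonneg (mul_nonneg ha.le (by linarith)) h1.le) ?_ 2
          gcongr
          exact mul_le_of_le_one_right ha.le (by linarith)
        have h4 : (2 * Real.pi * N * dipProfile a x) ^ 2 ≤ (2 * Real.pi * N) ^ 2 := by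
          rw [mul_pow]
          nlinarith [sq_nonneg (2 * Real.pi * N)]
        have h5 : 0 ≤ a / Real.tanh (a / 2) * (2 * Real.pi * N) := by
          have := Real.pi_pos
          positivity
        nlinarith
      · have := Real.pi_pos
        have h1 := tanh_pos (x := a / 2) (by positivity)
        positivity
    exact MemLp.of_bound (measurable_deriv _).aestronglyMeasurable _ hb
  · have h : dipProfile a 0 = -1 := by
      rw [dipProfile, show a * (0 - 1 / 2) = -(a / 2) by ring, Real.tanh_neg, neg_div,
        div_self ht]
    simp [jumpCompetitor, h, jumpSign, constTwist]
  · have h : dipProfile a 1 = 1 := by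
      rw [dipProfile, show a * (1 - 1 / 2) = a / 2 by ring, div_self ht]
    have h' : constTwist (2 * Real.pi * N) 1 = 1 := by
      rw [constTwist]
      have : Complex.I * ((2 * Real.pi * N * 1 : ℝ) : ℂ) =
        ((N : ℤ) : ℂ) * (2 * Real.pi * Complex.I) := by push_cast; ring
      rw [this, Complex.exp_int_mul_two_pi_mul_I]
    rw [jumpCompetitor, h, h', jumpSign, if_neg (by norm_num)]
    simp

/-- With t = tanh(a/2) the integral is 2(t - t³/3), and 2/3 - (t - t³/3) = (t - 1)²(t + 2)/3 ≥ 0. -/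
theorem integral_tanh_deriv_le (a : ℝ) :
    ∫ x in (0 : ℝ)..1, a * (1 - Real.tanh (a * (x - 1 / 2)) ^ 2) ^ 2 ≤ 4 / 3 := by
  have hd : ∀ x ∈ uIcc (0 : ℝ) 1, HasDerivAt (fun x : ℝ => Real.tanh (a * (x - 1 / 2)) -
      1 / 3 * Real.tanh (a * (x - 1 / 2)) ^ 3)
      (a * (1 - Real.tanh (a * (x - 1 / 2)) ^ 2) ^ 2) x := fun x _ => by
    have h : HasDerivAt (fun x : ℝ => a * (x - 1 / 2)) a x := by
      simpa only [mul_one, id] using ((hasDerivAt_id x).sub_const (1 / 2)).const_mul a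
    have h1 := (hasDerivAt_tanh _).comp x h
    refine (h1.sub ((h1.pow 3).const_mul (1 / 3))).congr_deriv ?_
    simp only [Function.comp]
    push_cast
    ring
  have hcont : Continuous Real.tanh := contDiff_tanh.continuous
  rw [intervalIntegral.integral_eq_sub_of_hasDerivAt hd
    (Continuous.intervalIntegrable (by fun_prop) _ _),
    show a * (0 - 1 / 2) = -(a / 2) by ring, show a * (1 - 1 / 2) = a / 2 by ring, Real.tanh_neg]
  have h1 := Real.tanh_lt_one (a / 2)
  have h2 := Real.neg_one_lt_tanh (a / 2)
  nlinarith [mul_nonneg (sq_nonneg (Real.tanh (a / 2) - 1)) (by linarith : 0 ≤ Real.tanh (a / 2) + 2)]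

/-- The scale 1/(√2 ε) balances the profile's gradient energy against the potential. The twist
defect is 2πN times the potential factor, so it only adds a relative error O(ε). Division by the
squared tanh pays for meeting the boundary values exactly. -/
theorem energy_jumpCompetitor_le {L : ℝ} (hL : 0 < L) (N : ℕ) (α : ℝ) {ε : ℝ} (hε : 0 < ε) :
    energy L N ε (jumpCompetitor N α (1 / (Real.sqrt 2 * ε))) ≤
      ε / 2 * (2 * Real.pi * N) ^ 2 + (1 + 2 * L * ε * (2 * Real.pi * N) ^ 2) *
        (2 * Real.sqrt 2 / 3) / Real.tanh (1 / (Real.sqrt 2 * ε) / 2) ^ 2 := by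
  set a := 1 / (Real.sqrt 2 * ε) with ha'
  have hs : 0 < Real.sqrt 2 := Real.sqrt_pos.2 (by norm_num)
  have hs2 : Real.sqrt 2 ^ 2 = 2 := Real.sq_sqrt (by norm_num)
  have ha : 0 < a := by positivity
  have ht := tanh_pos (x := a / 2) (by positivity)
  have ht1 : Real.tanh (a / 2) < 1 := Real.tanh_lt_one _
  set K := Real.tanh (a / 2) with hK
  have hne : ∀ᵐ x : ℝ, x ≠ 1 / 2 := by simp [ae_iff, measure_singleton]
  have e : energy L N ε (jumpCompetitor N α a) = ∫ x in (0 : ℝ)..1,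
      (ε / 2 * ((a * (1 - Real.tanh (a * (x - 1 / 2)) ^ 2) / K) ^ 2 +
        (2 * Real.pi * N * dipProfile a x) ^ 2) + 1 / (4 * ε) * (dipProfile a x ^ 2 - 1) ^ 2
      + L / 2 * (2 * Real.pi * N * dipProfile a x ^ 2 - 2 * Real.pi * N) ^ 2) := by
    rw [energy]
    refine intervalIntegral.integral_congr_ae ?_
    filter_upwards [hne] with x hx _
    rw [norm_deriv_jumpCompetitor_sq N α a hx, twist_jumpCompetitor N α a hx,
      norm_jumpCompetitor_sq]
  have hcont : Continuous Real.tanh := contDiff_tanh.continuous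
  have hcont' : Continuous (dipProfile a) := (contDiff_dipProfile a).continuous
  have hle := intervalIntegral.integral_mono_on (μ := volume) (a := 0) (b := 1) zero_le_one
    (f := fun x => (ε / 2 * ((a * (1 - Real.tanh (a * (x - 1 / 2)) ^ 2) / K) ^ 2 +
        (2 * Real.pi * N * dipProfile a x) ^ 2) + 1 / (4 * ε) * (dipProfile a x ^ 2 - 1) ^ 2
      + L / 2 * (2 * Real.pi * N * dipProfile a x ^ 2 - 2 * Real.pi * N) ^ 2))
    (g := fun x => ε / 2 * (2 * Real.pi * N) ^ 2 + (1 + 2 * L * ε * (2 * Real.pi * N) ^ 2) *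
      (1 / (Real.sqrt 2 * K ^ 2)) * (a * (1 - Real.tanh (a * (x - 1 / 2)) ^ 2) ^ 2))
    (Continuous.intervalIntegrable (by fun_prop) _ _)
    (Continuous.intervalIntegrable (by fun_prop) _ _) ?_
  · rw [e]
    refine hle.trans ?_
    rw [intervalIntegral.integral_add intervalIntegrable_const
      (Continuous.intervalIntegrable (by fun_prop) _ _),
      intervalIntegral.integral_const_mul
        ((1 + 2 * L * ε * (2 * Real.pi * N) ^ 2) * (1 / (Real.sqrt 2 * K ^ 2)))]
    have := mul_le_mul_of_nonneg_left (integral_tanh_deriv_le a)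
      (by positivity : 0 ≤ (1 + 2 * L * ε * (2 * Real.pi * N) ^ 2) * (1 / (Real.sqrt 2 * K ^ 2)))
    have e2 : (1 + 2 * L * ε * (2 * Real.pi * N) ^ 2) * (1 / (Real.sqrt 2 * K ^ 2)) * (4 / 3) =
        (1 + 2 * L * ε * (2 * Real.pi * N) ^ 2) * (2 * Real.sqrt 2 / 3) / K ^ 2 := by
      field_simp
      linear_combination (-2) * hs2
    simp only [intervalIntegral.integral_const, sub_zero, one_smul]
    linarith
  · intro x hx
    have h1 := dipProfile_sq_le_one ha hx
    have h0 := sq_nonneg (dipProfile a x)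
    have hd : dipProfile a x ^ 2 = Real.tanh (a * (x - 1 / 2)) ^ 2 / K ^ 2 := by
      rw [dipProfile, div_pow]
    have hT := Real.tanh_sq_lt_one (a * (x - 1 / 2))
    set τ := Real.tanh (a * (x - 1 / 2))
    have hT0 := sq_nonneg τ
    set s := dipProfile a x ^ 2 with hs'
    set q := (2 * Real.pi * N : ℝ)
    have hK1 : K ^ 2 ≤ 1 := by nlinarith
    have hq1 : (s - 1) ^ 2 ≤ (1 - τ ^ 2) ^ 2 / K ^ 2 := by
      have h3 : 1 - s ≤ 1 - τ ^ 2 := by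
        have : τ ^ 2 ≤ s := by
          rw [hd, le_div_iff₀ (by positivity)]
          nlinarith
        linarith
      rw [le_div_iff₀ (by positivity)]
      have : (s - 1) ^ 2 ≤ (1 - τ ^ 2) ^ 2 := by nlinarith
      nlinarith [sq_nonneg (s - 1)]
    set X := (1 - τ ^ 2) ^ 2 / K ^ 2 with hX
    have hX0 : 0 ≤ X := by positivity
    -- Equipartition: a² = 1/(2ε²) turns the gradient term into the bound for the potential term.
    have e1 : ε / 2 * (a * (1 - τ ^ 2) / K) ^ 2 = 1 / (4 * ε) * X := by
      rw [hX, ha']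
      field_simp
      rw [hs2]
      ring
    have e2 : (1 + 2 * L * ε * q ^ 2) * (1 / (Real.sqrt 2 * K ^ 2)) * (a * (1 - τ ^ 2) ^ 2) =
        (1 + 2 * L * ε * q ^ 2) * (1 / (2 * ε) * X) := by
      rw [hX, ha']
      field_simp
      rw [hs2]
    have e3 : (q * dipProfile a x) ^ 2 = q ^ 2 * s := by rw [mul_pow]
    have e4 : (q * s - q) ^ 2 = q ^ 2 * (s - 1) ^ 2 := by ring
    rw [mul_add, e1, e2, e3, e4]
    have f1 : 1 / (4 * ε) * (s - 1) ^ 2 ≤ 1 / (4 * ε) * X := by gcongr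
    have f2 : L / 2 * (q ^ 2 * (s - 1) ^ 2) ≤ L / 2 * (q ^ 2 * X) := by gcongr
    have f3 : ε / 2 * (q ^ 2 * s) ≤ ε / 2 * q ^ 2 := by
      gcongr
      nlinarith [sq_nonneg q]
    have f4 : (1 + 2 * L * ε * q ^ 2) * (1 / (2 * ε) * X) =
        1 / (4 * ε) * X + 1 / (4 * ε) * X + 2 * (L / 2 * (q ^ 2 * X)) := by
      field_simp
      ring
    have f5 : 0 ≤ L / 2 * (q ^ 2 * X) := by positivity
    linarith

end

/-! ### Consequences of an energy bound, the cost of dips, and an L² estimate. -/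

theorem abs_sub_one_le_abs_sq_sub_one {r : ℝ} (hr : 0 ≤ r) : |r - 1| ≤ |r ^ 2 - 1| := by
  have : r ^ 2 - 1 = (r - 1) * (r + 1) := by ring
  rw [this, abs_mul, abs_of_nonneg (by linarith : 0 ≤ r + 1)]
  nlinarith [abs_nonneg (r - 1)]

theorem modulusCost_le_self {r : ℝ} (hr : 0 ≤ r) : r - r ^ 3 / 3 ≤ r := by
  have := pow_nonneg hr 3
  linarith

namespace IsH1

variable {u : ℝ → ℂ}

section Energy

variable {L M ε : ℝ} {N : ℕ}

theorem integral_potential_sq_le (hu : IsH1 u) (hL : 0 < L) (hε : 0 < ε)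
    (hE : energy L N ε u ≤ M) : ∫ t in (0 : ℝ)..1, (‖u t‖ ^ 2 - 1) ^ 2 ≤ 4 * ε * M := by
  rw [hu.energy_eq] at hE
  have h1 : 0 ≤ ∫ t in (0 : ℝ)..1, ‖deriv u t‖ ^ 2 :=
    intervalIntegral.integral_nonneg zero_le_one fun _ _ => sq_nonneg _
  have h3 : 0 ≤ ∫ t in (0 : ℝ)..1, (twist u t - 2 * Real.pi * N) ^ 2 :=
    intervalIntegral.integral_nonneg zero_le_one fun _ _ => sq_nonneg _
  have h4 := mul_nonneg (by positivity : 0 ≤ ε / 2) h1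
  have h5 := mul_nonneg (by positivity : 0 ≤ L / 2) h3
  have h6 : 1 / (4 * ε) * (∫ t in (0 : ℝ)..1, (‖u t‖ ^ 2 - 1) ^ 2) ≤ M := by linarith
  rw [one_div_mul_eq_div, div_le_iff₀ (by positivity)] at h6
  linarith

theorem integral_twist_sub_sq_le (hu : IsH1 u) (hL : 0 < L) (hε : 0 < ε)
    (hE : energy L N ε u ≤ M) :
    ∫ t in (0 : ℝ)..1, (twist u t - 2 * Real.pi * N) ^ 2 ≤ 2 * M / L := by
  rw [hu.energy_eq] at hE
  have h1 : 0 ≤ ∫ t in (0 : ℝ)..1, ‖deriv u t‖ ^ 2 :=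
    intervalIntegral.integral_nonneg zero_le_one fun _ _ => sq_nonneg _
  have h2 : 0 ≤ ∫ t in (0 : ℝ)..1, (‖u t‖ ^ 2 - 1) ^ 2 :=
    intervalIntegral.integral_nonneg zero_le_one fun _ _ => sq_nonneg _
  have h4 := mul_nonneg (by positivity : 0 ≤ ε / 2) h1
  have h5 := mul_nonneg (by positivity : 0 ≤ 1 / (4 * ε)) h2
  rw [le_div_iff₀ hL]
  linarith

/-- Young's inequality with weight √ε: the twist is O(1) in L² and the potential squared has
integral O(ε), so both halves are O(√ε). -/
theorem integral_twist_mul_potential_le (hu : IsH1 u) (hL : 0 < L) (hε : 0 < ε)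
    (hE : energy L N ε u ≤ M) :
    ∫ t in (0 : ℝ)..1, |twist u t| * |‖u t‖ ^ 2 - 1| ≤
      Real.sqrt ε * (2 * M / L + (2 * Real.pi * N) ^ 2 + 2 * M) := by
  have hp := hu.integral_potential_sq_le hL hε hE
  have ht := hu.integral_twist_sub_sq_le hL hε hE
  set κ : ℝ := 2 * Real.pi * N
  have hs : 0 < Real.sqrt ε := Real.sqrt_pos.2 hε
  have hs2 : Real.sqrt ε ^ 2 = ε := Real.sq_sqrt hε.le
  have i1 := hu.intervalIntegrable_twist_sub_sq κ
  have i2 := hu.intervalIntegrable_potential_sq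
  set s := Real.sqrt ε
  have hle : ∫ t in (0 : ℝ)..1, |twist u t| * |‖u t‖ ^ 2 - 1| ≤
      ∫ t in (0 : ℝ)..1, ((s * (twist u t - κ) ^ 2 + s * κ ^ 2)
        + 1 / (2 * s) * (‖u t‖ ^ 2 - 1) ^ 2) := by
    refine intervalIntegral.integral_mono_on zero_le_one hu.intervalIntegrable_twist_mul_potential
      (((i1.const_mul _).add intervalIntegrable_const).add (i2.const_mul _)) fun t _ => ?_
    have h1 : |twist u t| * |‖u t‖ ^ 2 - 1| ≤
        s / 2 * twist u t ^ 2 + 1 / (2 * s) * (‖u t‖ ^ 2 - 1) ^ 2 := by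
      rw [← sq_abs (twist u t), ← sq_abs (‖u t‖ ^ 2 - 1)]
      set p := |twist u t|
      set q := |‖u t‖ ^ 2 - 1|
      have : s / 2 * p ^ 2 + 1 / (2 * s) * q ^ 2 - p * q = 1 / (2 * s) * (s * p - q) ^ 2 := by
        field_simp
        ring
      have h0 : 0 ≤ 1 / (2 * s) * (s * p - q) ^ 2 := by positivity
      linarith
    have h2 : s / 2 * twist u t ^ 2 ≤ s * (twist u t - κ) ^ 2 + s * κ ^ 2 := by
      nlinarith [mul_nonneg hs.le (sq_nonneg (twist u t - 2 * κ))]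
    linarith
  rw [intervalIntegral.integral_add ((i1.const_mul _).add intervalIntegrable_const)
    (i2.const_mul _), intervalIntegral.integral_add (i1.const_mul _) intervalIntegrable_const,
    intervalIntegral.integral_const_mul, intervalIntegral.integral_const_mul (1 / (2 * s))] at hle
  simp only [intervalIntegral.integral_const, sub_zero, one_smul] at hle
  have h3 : 1 / (2 * s) * (∫ t in (0 : ℝ)..1, (‖u t‖ ^ 2 - 1) ^ 2) ≤ s * (2 * M) := by
    rw [one_div_mul_eq_div, div_le_iff₀ (by positivity)]
    calc _ ≤ 4 * ε * M := hp
      _ = s * (2 * M) * (2 * s) := by rw [← hs2]; ring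
  have h4 := mul_le_mul_of_nonneg_left ht hs.le
  linarith

end Energy

/-- Variation of G(r) = r - r³/3 along |u| through 0, p, z, q, 1, descending to p, rising to z,
descending to q and rising to 1; here G(1) = 2/3. -/
theorem two_dip_cost (hu : IsH1 u) (h0 : ‖u 0‖ = 1) (h1 : ‖u 1‖ = 1) {p z q : ℝ} (hp : 0 ≤ p)
    (hpz : p ≤ z) (hzq : z ≤ q) (hq : q ≤ 1) :
    4 / 3 - 2 * (‖u p‖ - ‖u p‖ ^ 3 / 3) - 2 * (‖u q‖ - ‖u q‖ ^ 3 / 3)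
      + 2 * (‖u z‖ - ‖u z‖ ^ 3 / 3) ≤
      ∫ t in (0 : ℝ)..1, |‖u t‖ ^ 2 - 1| * ‖deriv u t‖ := by
  have i := hu.intervalIntegrable_potential_mul_deriv
  have a1 := (abs_le.1 (hu.abs_modulus_sub_le le_rfl hp (by linarith))).1
  have a2 := (abs_le.1 (hu.abs_modulus_sub_le hp hpz (by linarith))).2
  have a3 := (abs_le.1 (hu.abs_modulus_sub_le (by linarith) hzq hq)).1
  have a4 := (abs_le.1 (hu.abs_modulus_sub_le (by linarith) hq le_rfl)).2
  have j1 := i.mono_set (uIcc_subset_unit le_rfl hp (by linarith))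
  have j2 := i.mono_set (uIcc_subset_unit hp hpz (by linarith))
  have j3 := i.mono_set (uIcc_subset_unit (by linarith) hzq hq)
  have j4 := i.mono_set (uIcc_subset_unit (by linarith) hq le_rfl)
  have e1 := intervalIntegral.integral_add_adjacent_intervals j1 j2
  have e2 := intervalIntegral.integral_add_adjacent_intervals (j1.trans j2) j3
  have e3 := intervalIntegral.integral_add_adjacent_intervals ((j1.trans j2).trans j3) j4
  rw [h0] at a1
  rw [h1] at a4
  linarith

/-- The degenerate case p = z = q of `two_dip_cost`. -/
theorem one_dip_cost (hu : IsH1 u) (h0 : ‖u 0‖ = 1) (h1 : ‖u 1‖ = 1) {p : ℝ}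
    (hp : p ∈ Icc (0 : ℝ) 1) :
    4 / 3 - 2 * ‖u p‖ ≤ ∫ t in (0 : ℝ)..1, |‖u t‖ ^ 2 - 1| * ‖deriv u t‖ := by
  have := hu.two_dip_cost h0 h1 hp.1 le_rfl le_rfl hp.2
  have := modulusCost_le_self (norm_nonneg (u p))
  linarith

/-- On an interval of length at least `δ` the modulus is somewhere close to `1`. -/
theorem exists_potential_sq_le (hu : IsH1 u) {p q δ R : ℝ} (hp : 0 ≤ p) (hδ : 0 < δ)
    (hpq : p + δ ≤ q) (hq : q ≤ 1) (hR : ∫ t in (0 : ℝ)..1, (‖u t‖ ^ 2 - 1) ^ 2 ≤ R) :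
    ∃ z ∈ Icc p q, (‖u z‖ ^ 2 - 1) ^ 2 ≤ R / δ := by
  by_contra! h
  have hpq' : p ≤ q := by linarith
  have i := hu.intervalIntegrable_potential_sq
  have hR0 : 0 ≤ R := le_trans
    (intervalIntegral.integral_nonneg zero_le_one fun _ _ => sq_nonneg _) hR
  obtain ⟨z, hz, hmin⟩ := isCompact_Icc.exists_isMinOn (nonempty_Icc.2 hpq')
    (((hu.continuousOn_potential.pow 2)).mono
      (by rw [← uIcc_of_le hpq']; exact uIcc_subset_unit hp hpq' hq))
  have h1 : (q - p) * (‖u z‖ ^ 2 - 1) ^ 2 ≤ ∫ t in p..q, (‖u t‖ ^ 2 - 1) ^ 2 := by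
    have := intervalIntegral.integral_mono_on (μ := volume) hpq' intervalIntegrable_const
      (i.mono_set (uIcc_subset_unit hp hpq' hq)) (fun t ht => isMinOn_iff.1 hmin t ht)
    simpa using this
  have h2 := intervalIntegral_le_of_subinterval i (fun _ => sq_nonneg _) hp hpq' hq
  have h3 := h z hz
  rw [div_lt_iff₀ hδ] at h3
  have h4 : (‖u z‖ ^ 2 - 1) ^ 2 * δ ≤ (q - p) * (‖u z‖ ^ 2 - 1) ^ 2 := by
    nlinarith [sq_nonneg (‖u z‖ ^ 2 - 1)]
  linarith

/-- Two well separated points cannot both have small modulus, at the price of one dip. -/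
theorem half_le_norm_of_dip (hu : IsH1 u) (h0 : ‖u 0‖ = 1) (h1 : ‖u 1‖ = 1) {x y δ R : ℝ}
    (hx : x ∈ Icc (0 : ℝ) 1) (hy : y ∈ Icc (0 : ℝ) 1) (hδ : 0 < δ) (hxy : δ ≤ |y - x|)
    (hR : ∫ t in (0 : ℝ)..1, (‖u t‖ ^ 2 - 1) ^ 2 ≤ R) (hRδ : R / δ ≤ 1)
    (hcost : ∫ t in (0 : ℝ)..1, |‖u t‖ ^ 2 - 1| * ‖deriv u t‖ <
      4 / 3 + 5 / 12 - 2 * ‖u x‖ - 8 / 3 * (R / δ)) : 1 / 2 ≤ ‖u y‖ := by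
  by_contra! hlt
  -- 11/24 is the value of r - r³/3 at 1/2. The second dip thus costs at least 4/3 - 2 · 11/24 =
  -- 5/12, up to the error at z.
  have hGy : ‖u y‖ - ‖u y‖ ^ 3 / 3 ≤ 11 / 24 := by
    have := norm_nonneg (u y)
    nlinarith [mul_nonneg this this, mul_nonneg (mul_nonneg this this) (sub_nonneg.2 hlt.le),
      mul_nonneg this (sub_nonneg.2 hlt.le)]
  have hGx := modulusCost_le_self (norm_nonneg (u x))
  have hGz : ∀ z, (‖u z‖ ^ 2 - 1) ^ 2 ≤ R / δ →
      2 / 3 - 4 / 3 * (R / δ) ≤ ‖u z‖ - ‖u z‖ ^ 3 / 3 := by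
    intro z hz
    have hr := norm_nonneg (u z)
    set r := ‖u z‖
    have h2 : (r - 1) ^ 2 ≤ R / δ := by
      refine le_trans ?_ hz
      exact sq_le_sq.2 (abs_sub_one_le_abs_sq_sub_one hr)
    have h3 : r ≤ 2 := by nlinarith
    -- r - r³/3 = 2/3 - (r - 1)²(r + 2)/3, and r + 2 ≤ 4.
    nlinarith [sq_nonneg (r - 1), mul_nonneg (sq_nonneg (r - 1)) (by linarith : 0 ≤ 2 - r)]
  rcases le_total x y with h | h
  · rw [abs_of_nonneg (by linarith)] at hxy
    obtain ⟨z, hz, hz'⟩ := hu.exists_potential_sq_le hx.1 hδ (by linarith : x + δ ≤ y) hy.2 hR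
    have := hu.two_dip_cost h0 h1 hx.1 hz.1 hz.2 hy.2
    have := hGz z hz'
    linarith
  · rw [abs_of_nonpos (by linarith)] at hxy
    obtain ⟨z, hz, hz'⟩ := hu.exists_potential_sq_le hy.1 hδ (by linarith : y + δ ≤ x) hx.2 hR
    have := hu.two_dip_cost h0 h1 hy.1 hz.1 hz.2 hx.2
    have := hGz z hz'
    linarith

theorem eLpNorm_sub_le (hu : IsH1 u) {v : ℝ → ℂ} {B x₀ δ R : ℝ} (hδ : 0 ≤ δ)
    (hR : ∫ t in (0 : ℝ)..1, (‖u t‖ ^ 2 - 1) ^ 2 ≤ R)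
    (h : ∀ x ∈ Ioo (0 : ℝ) 1, ‖u x - v x‖ ≤
      |‖u x‖ ^ 2 - 1| + B + (Ioc (x₀ - δ) (x₀ + δ)).indicator (fun _ => (2 : ℝ)) x) :
    eLpNorm (fun x => u x - v x) 2 (volume.restrict (Ioo (0 : ℝ) 1)) ≤
      ENNReal.ofReal (Real.sqrt (3 * R + 3 * B ^ 2 + 24 * δ)) := by
  set S := Ioc (x₀ - δ) (x₀ + δ)
  have hSm : MeasurableSet S := measurableSet_Ioc
  -- From (a + b + 2)² ≤ 3a² + 3b² + 12; the window has length 2δ, which gives the term 24δ.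
  set g : ℝ → ℝ := fun x => 3 * (‖u x‖ ^ 2 - 1) ^ 2 + 3 * B ^ 2 + S.indicator (fun _ => 12) x
    with hg
  have hg0 : ∀ x, 0 ≤ g x := fun x => by
    have : 0 ≤ S.indicator (fun _ => (12 : ℝ)) x := indicator_nonneg (fun _ _ => by norm_num) x
    simp only [hg]
    positivity
  have hSi : IntegrableOn (S.indicator fun _ => (12 : ℝ)) (Ioc 0 1) volume :=
    (integrable_const _).indicator hSm
  have hp := hu.intervalIntegrable_potential_sq
  rw [intervalIntegral.integral_of_le zero_le_one] at hR
  rw [intervalIntegrable_iff_integrableOn_Ioc_of_le zero_le_one] at hp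
  have hgi : IntegrableOn g (Ioc 0 1) volume :=
    ((hp.const_mul 3).add (integrable_const _)).add hSi
  have hint : ∫ x in Ioc (0 : ℝ) 1, g x ≤ 3 * R + 3 * B ^ 2 + 24 * δ := by
    have e : ∫ x in Ioc (0 : ℝ) 1, g x = 3 * (∫ x in Ioc (0 : ℝ) 1, (‖u x‖ ^ 2 - 1) ^ 2)
        + 3 * B ^ 2 + ∫ x in Ioc (0 : ℝ) 1, S.indicator (fun _ => 12) x := by
      simp only [hg]
      have hp' : Integrable (fun x => 3 * (‖u x‖ ^ 2 - 1) ^ 2) (volume.restrict (Ioc (0 : ℝ) 1)) :=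
        Integrable.const_mul hp 3
      have hp'' : Integrable (fun x => 3 * (‖u x‖ ^ 2 - 1) ^ 2 + 3 * B ^ 2)
        (volume.restrict (Ioc (0 : ℝ) 1)) := hp'.add (integrable_const _)
      rw [integral_add hp'' hSi, integral_add hp' (integrable_const _), integral_const_mul]
      simp
    have hS : ∫ x in Ioc (0 : ℝ) 1, S.indicator (fun _ => (12 : ℝ)) x ≤ 24 * δ := by
      rw [integral_indicator hSm, Measure.restrict_restrict hSm, setIntegral_const, smul_eq_mul]
      have : volume.real (S ∩ Ioc 0 1) ≤ 2 * δ := by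
        refine (measureReal_mono inter_subset_left (by simp [S])).trans ?_
        simp only [S, Real.volume_real_Ioc]
        rw [max_eq_left (by linarith)]
        linarith
      linarith
    linarith
  rw [restrict_Ioo_eq_restrict_Ioc]
  have hae : ∀ᵐ x ∂volume.restrict (Ioc (0 : ℝ) 1), ‖u x - v x‖ ≤ Real.sqrt (g x) := by
    rw [← restrict_Ioo_eq_restrict_Ioc]
    filter_upwards [ae_restrict_mem measurableSet_Ioo] with x hx
    refine (h x hx).trans (Real.le_sqrt_of_sq_le ?_)
    by_cases hxS : x ∈ S
    · simp only [hg, indicator_of_mem hxS]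
      rw [← sq_abs (‖u x‖ ^ 2 - 1)]
      nlinarith [sq_nonneg (|‖u x‖ ^ 2 - 1| - B), sq_nonneg (|‖u x‖ ^ 2 - 1| - 2),
        sq_nonneg (B - 2)]
    · simp only [hg, indicator_of_notMem hxS]
      rw [← sq_abs (‖u x‖ ^ 2 - 1)]
      nlinarith [sq_nonneg (|‖u x‖ ^ 2 - 1| - B), sq_nonneg (|‖u x‖ ^ 2 - 1|), sq_nonneg B]
  refine (eLpNorm_mono_ae_real hae).trans ?_
  have hsm : AEStronglyMeasurable (fun x => Real.sqrt (g x)) (volume.restrict (Ioc (0 : ℝ) 1)) :=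
    Real.continuous_sqrt.comp_aestronglyMeasurable hgi.aestronglyMeasurable
  have hmem : MemLp (fun x => Real.sqrt (g x)) 2 (volume.restrict (Ioc (0 : ℝ) 1)) := by
    rw [memLp_two_iff_integrable_sq hsm]
    simp_rw [Real.sq_sqrt (hg0 _)]
    exact hgi
  rw [hmem.eLpNorm_eq_integral_rpow_norm (by norm_num) (by norm_num)]
  refine ENNReal.ofReal_le_ofReal ?_
  rw [Real.sqrt_eq_rpow]
  simp only [ENNReal.toReal_ofNat, Real.rpow_two, Real.norm_eq_abs, sq_abs, Real.sq_sqrt (hg0 _)]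
  rw [show ((2 : ℝ)⁻¹) = 1 / 2 by norm_num]
  exact Real.rpow_le_rpow (integral_nonneg hg0) hint (by norm_num)

end IsH1

/-! ### Boundary values: winding number and distance to the limit maps. -/

namespace Admissible

variable {u : ℝ → ℂ} {α : ℝ}

theorem norm_zero (hu : Admissible α u) : ‖u 0‖ = 1 := by rw [hu.2.1]; simp

theorem norm_one (hu : Admissible α u) : ‖u 1‖ = 1 := by
  rw [hu.2.2]; exact Complex.norm_exp_I_mul_ofReal _

/-- The total twist of a map without zeros is close to a lift of the boundary phase. -/
theorem exists_winding (hu : Admissible α u) {c : ℝ} (hc : 0 < c)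
    (hcu : ∀ t ∈ Icc (0 : ℝ) 1, c ≤ ‖u t‖) :
    ∃ k : ℤ, |(∫ t in (0 : ℝ)..1, twist u t) - (2 * Real.pi * k + α)| ≤
      1 / c ^ 2 * ∫ t in (0 : ℝ)..1, |twist u t| * |‖u t‖ ^ 2 - 1| := by
  obtain ⟨θ, h1, h2⟩ := hu.1.exists_phase hc le_rfl zero_le_one le_rfl hcu
  rw [hu.norm_zero, hu.norm_one, hu.2.1, hu.2.2] at h1
  simp only [Complex.ofReal_one, div_one, one_mul] at h1
  -- The boundary values fix the phase increment modulo 2π.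
  obtain ⟨n, hn⟩ := Complex.exp_eq_exp_iff_exists_int.1 h1.symm
  refine ⟨n, ?_⟩
  have : θ = 2 * Real.pi * n + α := by
    have := congrArg Complex.im hn
    simp at this
    linarith
  rw [← this, abs_sub_comm]
  exact h2

theorem norm_sub_direction (u : ℝ → ℂ) (x : ℝ) (hx : u x ≠ 0) :
    ‖u x - u x / ‖u x‖‖ ≤ |‖u x‖ ^ 2 - 1| := by
  have h : (‖u x‖ : ℂ) ≠ 0 := by simpa using hx
  have e : u x - u x / ‖u x‖ = u x / ‖u x‖ * ((‖u x‖ - 1 : ℝ) : ℂ) := by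
    push_cast
    field_simp
  rw [e, norm_mul, Complex.norm_real, norm_div, Complex.norm_real, norm_norm,
    div_self (by simpa using hx), one_mul, Real.norm_eq_abs]
  exact abs_sub_one_le_abs_sq_sub_one (norm_nonneg _)

theorem norm_sub_constTwist_le (hu : Admissible α u) {c x κ : ℝ} (hc : 0 < c)
    (hx : x ∈ Icc (0 : ℝ) 1) (hcu : ∀ t ∈ Icc 0 x, c ≤ ‖u t‖) :
    ‖u x - constTwist κ x‖ ≤ |‖u x‖ ^ 2 - 1| +
      (1 / c ^ 2 * (∫ t in (0 : ℝ)..1, |twist u t| * |‖u t‖ ^ 2 - 1|)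
        + ∫ t in (0 : ℝ)..1, |twist u t - κ|) := by
  have h := hu.1.norm_direction_sub_le κ hc le_rfl hx.1 hx.2 hcu
  have hux : u x ≠ 0 := fun h0 => by
    have := hcu x (right_mem_Icc.2 hx.1)
    rw [h0, _root_.norm_zero] at this
    linarith
  rw [hu.norm_zero, hu.2.1] at h
  simp only [Complex.ofReal_one, div_one, one_mul, sub_zero] at h
  have h' := norm_sub_direction u x hux
  have e : u x - constTwist κ x = (u x - u x / ‖u x‖) +
      (u x / ‖u x‖ - Complex.exp (Complex.I * (κ * x : ℝ))) := by
    rw [constTwist]; ring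
  rw [e]
  exact (norm_add_le _ _).trans (add_le_add h' h)

/-- The phase is transported back from the endpoint 1. Since N is an integer, the phase 2πNx + α
matches the boundary value there. -/
theorem norm_sub_constTwist_right_le (hu : Admissible α u) {c x : ℝ} (N : ℕ) (hc : 0 < c)
    (hx : x ∈ Icc (0 : ℝ) 1) (hcu : ∀ t ∈ Icc x 1, c ≤ ‖u t‖) :
    ‖u x - Complex.exp (Complex.I * (2 * Real.pi * N * x + α : ℝ))‖ ≤ |‖u x‖ ^ 2 - 1| +
      (1 / c ^ 2 * (∫ t in (0 : ℝ)..1, |twist u t| * |‖u t‖ ^ 2 - 1|)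
        + ∫ t in (0 : ℝ)..1, |twist u t - 2 * Real.pi * N|) := by
  have h := hu.1.norm_direction_sub_le (2 * Real.pi * N) hc hx.1 hx.2 le_rfl hcu
  have hux : u x ≠ 0 := fun h0 => by
    have := hcu x (left_mem_Icc.2 hx.2)
    rw [h0, _root_.norm_zero] at this
    linarith
  rw [hu.norm_one, hu.2.2] at h
  simp only [Complex.ofReal_one, div_one] at h
  have h' := norm_sub_direction u x hux
  set E := Complex.exp (Complex.I * (2 * Real.pi * N * (1 - x) : ℝ)) with hE
  have e1 : Complex.exp (Complex.I * (2 * Real.pi * N * x + α : ℝ)) * E =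
      Complex.exp (Complex.I * α) := by
    rw [hE, ← Complex.exp_add]
    have : Complex.I * ((2 * Real.pi * N * x + α : ℝ) : ℂ) +
        Complex.I * ((2 * Real.pi * N * (1 - x) : ℝ) : ℂ) =
        Complex.I * α + ((N : ℤ) : ℂ) * (2 * Real.pi * Complex.I) := by
      push_cast
      ring
    rw [this, Complex.exp_add, Complex.exp_int_mul_two_pi_mul_I, mul_one]
  have e2 : ‖u x / ‖u x‖ - Complex.exp (Complex.I * (2 * Real.pi * N * x + α : ℝ))‖ =
      ‖Complex.exp (Complex.I * α) - u x / ‖u x‖ * E‖ := by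
    rw [← e1, ← sub_mul, norm_mul, hE, Complex.norm_exp_I_mul_ofReal, mul_one, norm_sub_rev]
  have e : u x - Complex.exp (Complex.I * (2 * Real.pi * N * x + α : ℝ)) = (u x - u x / ‖u x‖) +
      (u x / ‖u x‖ - Complex.exp (Complex.I * (2 * Real.pi * N * x + α : ℝ))) := by
    ring
  rw [e]
  exact (norm_add_le _ _).trans (add_le_add h' (e2.le.trans h))

end Admissible

/-! ### Asymptotics below and above the threshold. -/

/-- `C` in the bound `∫ |T| ||u|² - 1| ≤ √ε C` for maps of energy at most `M`. -/
noncomputable def couplingConst (L M : ℝ) (N : ℕ) : ℝ :=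
  2 * M / L + (2 * Real.pi * N) ^ 2 + 2 * M

theorem couplingConst_nonneg {L M : ℝ} (hL : 0 < L) (hM : 0 ≤ M) (N : ℕ) :
    0 ≤ couplingConst L M N := by
  unfold couplingConst
  positivity

/-- Below the threshold no vortex forms: low energy maps are close to maps of constant twist. -/
theorem exists_close_constTwist {L α β D : ℝ} {N : ℕ} (hL : 0 < L) (hD : 0 ≤ D)
    (hβ : L * β ^ 2 < 4 * Real.sqrt 2 / 3) {v : ℕ → ℝ → ℂ} {ε : ℕ → ℝ} (hε : ∀ j, 0 < ε j)
    (hε0 : Tendsto ε atTop (𝓝 0)) (hv : ∀ j, Admissible α (v j))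
    (hE : ∀ j, energy L N (ε j) (v j) ≤ ε j * D + L / 2 * β ^ 2) :
    ∃ R : ℕ → ℝ, Tendsto R atTop (𝓝 0) ∧ ∀ᶠ j in atTop, ∃ k : ℤ,
      |2 * Real.pi * (k - N) + α| ≤ |β| + R j ∧
      (|2 * Real.pi * (k - N) + α| = |β| →
        eLpNorm (fun x => v j x - constTwist (2 * Real.pi * k + α) x) 2
          (volume.restrict (Ioo (0 : ℝ) 1)) ≤ ENNReal.ofReal (R j)) := by
  have hs : 0 < Real.sqrt 2 := Real.sqrt_pos.2 (by norm_num)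
  have hs2 : Real.sqrt 2 * Real.sqrt 2 = 2 := Real.mul_self_sqrt (by norm_num)
  -- The energy gap to a full dip. Half of it absorbs the O(ε) term; the other half gives 2|u| ≥
  -- g/2, hence the lower bound c = g/4.
  set g := 4 / 3 - Real.sqrt 2 * (L / 2 * β ^ 2) with hg
  have hgpos : 0 < g := by nlinarith
  set M := D + L / 2 * β ^ 2 with hM
  have hM0 : 0 ≤ M := by positivity
  set C := couplingConst L M N with hC
  have hC0 : 0 ≤ C := couplingConst_nonneg hL hM0 N
  set c := g / 4 with hc
  have hc0 : 0 < c := by positivity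
  set η : ℝ → ℝ := fun e => 1 / c ^ 2 * (Real.sqrt e * C) with hη
  have hη0 : ∀ e, 0 ≤ η e := fun e => by simp only [hη]; positivity
  -- `R1` bounds the excess of the winding defect over |β| and `R2` the L² distance. Both are
  -- continuous in e and vanish at 0, so their sum serves as a single error.
  set R1 : ℝ → ℝ := fun e => Real.sqrt (2 * e * D / L + β ^ 2) - |β| + η e with hR1
  set R2 : ℝ → ℝ := fun e => Real.sqrt (3 * (4 * e * M) +
    3 * (η e + Real.sqrt (2 * e * D / L + 2 * |β| * η e)) ^ 2 + 24 * 0) with hR2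
  have hcont : Continuous fun e => R1 e + R2 e := by
    simp only [hR1, hR2, hη]
    fun_prop
  have hzero : R1 0 + R2 0 = 0 := by
    simp [hR1, hR2, hη, Real.sqrt_sq_eq_abs]
  refine ⟨fun j => R1 (ε j) + R2 (ε j), ?_, ?_⟩
  · have := (hcont.tendsto 0).comp hε0
    rwa [hzero] at this
  have hsmall : ∀ᶠ j in atTop, Real.sqrt 2 * (ε j * D) < g / 2 := by
    have : Tendsto (fun j => Real.sqrt 2 * (ε j * D)) atTop (𝓝 (Real.sqrt 2 * (0 * D))) :=
      (hε0.mul_const D).const_mul _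
    refine this.eventually_lt_const ?_
    simpa using by positivity
  filter_upwards [hsmall, hε0.eventually_lt_const zero_lt_one] with j hj hj1
  set e := ε j with he
  have he0 : 0 < e := hε j
  have hu := hv j
  set u := v j
  have hEj : energy L N e u ≤ e * D + L / 2 * β ^ 2 := hE j
  have hEM : energy L N e u ≤ M := by
    refine hEj.trans ?_
    have : e * D ≤ D := mul_le_of_le_one_left hD hj1.le
    linarith
  have hcu : ∀ t ∈ Icc (0 : ℝ) 1, c ≤ ‖u t‖ := fun t ht => by
    have h1 := hu.1.one_dip_cost hu.norm_zero hu.norm_one ht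
    have h2 := hu.1.integral_potential_mul_deriv_le L N he0
    have h3 : 0 ≤ ∫ t in (0 : ℝ)..1, (twist u t - 2 * Real.pi * N) ^ 2 :=
      intervalIntegral.integral_nonneg zero_le_one fun _ _ => sq_nonneg _
    have h4 : Real.sqrt 2 * (energy L N e u
        - L / 2 * ∫ t in (0 : ℝ)..1, (twist u t - 2 * Real.pi * N) ^ 2) ≤
        Real.sqrt 2 * (e * D + L / 2 * β ^ 2) := by
      gcongr
      have := mul_nonneg (by positivity : 0 ≤ L / 2) h3
      linarith
    linarith
  have hP : 1 / c ^ 2 * (∫ t in (0 : ℝ)..1, |twist u t| * |‖u t‖ ^ 2 - 1|) ≤ η e := by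
    simp only [hη]
    gcongr
    exact hu.1.integral_twist_mul_potential_le hL he0 hEM
  obtain ⟨k, hk⟩ := hu.exists_winding hc0 hcu
  have hk' := hk.trans hP
  have hT2 : ∫ t in (0 : ℝ)..1, (twist u t - 2 * Real.pi * N) ^ 2 ≤ 2 * e * D / L + β ^ 2 := by
    refine (hu.1.integral_twist_sub_sq_le hL he0 hEj).trans (le_of_eq ?_)
    field_simp
  have hTi := hu.1.intervalIntegrable_twist
  have e1 : ∀ κ : ℝ, ∫ t in (0 : ℝ)..1, (twist u t - κ) = (∫ t in (0 : ℝ)..1, twist u t) - κ :=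
    fun κ => by
    rw [intervalIntegral.integral_sub hTi intervalIntegrable_const]
    simp
  have hT1 : |(∫ t in (0 : ℝ)..1, twist u t) - 2 * Real.pi * N| ≤
      Real.sqrt (2 * e * D / L + β ^ 2) := by
    refine Real.abs_le_sqrt (le_trans ?_ hT2)
    rw [← e1]
    exact sq_integral_le (hTi.sub intervalIntegrable_const)
      (hu.1.intervalIntegrable_twist_sub_sq _)
  have hR2n : 0 ≤ R2 e := Real.sqrt_nonneg _
  have hR1n : 0 ≤ R1 e := by
    have : |β| ≤ Real.sqrt (2 * e * D / L + β ^ 2) := by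
      refine Real.abs_le_sqrt ?_
      have : 0 ≤ 2 * e * D / L := by positivity
      linarith
    have := hη0 e
    simp only [hR1]
    linarith
  refine ⟨k, ?_, fun hkβ => ?_⟩
  · have h1 : |2 * Real.pi * (k - N) + α| ≤ Real.sqrt (2 * e * D / L + β ^ 2) + η e := by
      have : 2 * Real.pi * (k - N) + α = ((∫ t in (0 : ℝ)..1, twist u t) - 2 * Real.pi * N) -
        ((∫ t in (0 : ℝ)..1, twist u t) - (2 * Real.pi * k + α)) := by ring
      rw [this]
      exact (abs_sub _ _).trans (add_le_add hT1 hk')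
    simp only [hR1]
    simp only [hR1] at hR1n
    linarith
  · set γ := 2 * Real.pi * (k - N) + α with hγ
    set κ := 2 * Real.pi * k + α with hκ
    set m := ∫ t in (0 : ℝ)..1, twist u t with hm
    have hκγ : κ = 2 * Real.pi * N + γ := by rw [hκ, hγ]; ring
    have hγβ : γ ^ 2 = β ^ 2 := by rw [← sq_abs γ, hkβ, sq_abs]
    -- Expansion about κ instead of 2πN. As γ² = β², the leading terms cancel and only the O(ε)
    -- energy excess and the mean error m - κ remain.
    have hexp : ∫ t in (0 : ℝ)..1, (twist u t - κ) ^ 2 =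
        (∫ t in (0 : ℝ)..1, (twist u t - 2 * Real.pi * N) ^ 2) - 2 * γ * (m - κ) - γ ^ 2 := by
      have : ∀ t, (twist u t - κ) ^ 2 = (twist u t - 2 * Real.pi * N) ^ 2
          - 2 * γ * (twist u t - κ) - γ ^ 2 := fun t => by rw [hκγ]; ring
      simp_rw [this]
      rw [intervalIntegral.integral_sub ((hu.1.intervalIntegrable_twist_sub_sq _).sub
        ((hTi.sub intervalIntegrable_const).const_mul _)) intervalIntegrable_const,
        intervalIntegral.integral_sub (hu.1.intervalIntegrable_twist_sub_sq _)
        ((hTi.sub intervalIntegrable_const).const_mul _),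
        intervalIntegral.integral_const_mul, e1]
      simp
    have hTκ : ∫ t in (0 : ℝ)..1, (twist u t - κ) ^ 2 ≤ 2 * e * D / L + 2 * |β| * η e := by
      have h1 : -(2 * γ * (m - κ)) ≤ 2 * |β| * η e := by
        calc -(2 * γ * (m - κ)) ≤ |2 * γ * (m - κ)| := neg_le_abs _
          _ = 2 * |β| * |m - κ| := by rw [abs_mul, abs_mul, hkβ]; norm_num
          _ ≤ 2 * |β| * η e := by gcongr
      rw [hexp]
      linarith
    have habs : ∫ t in (0 : ℝ)..1, |twist u t - κ| ≤
        Real.sqrt (2 * e * D / L + 2 * |β| * η e) := by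
      refine Real.le_sqrt_of_sq_le (le_trans ?_ hTκ)
      have h1 := sq_integral_le (hu.1.intervalIntegrable_abs_twist_sub κ) (by
        simp_rw [sq_abs]
        exact hu.1.intervalIntegrable_twist_sub_sq κ)
      simpa only [sq_abs] using h1
    have := hu.1.eLpNorm_sub_le (v := constTwist κ)
      (B := η e + Real.sqrt (2 * e * D / L + 2 * |β| * η e)) (x₀ := 0) le_rfl
      (hu.1.integral_potential_sq_le hL he0 hEM) (fun x hx => by
        have h1 := hu.norm_sub_constTwist_le (κ := κ) hc0 (Ioo_subset_Icc_self hx)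
          (fun t ht => hcu t ⟨ht.1, ht.2.trans hx.2.le⟩)
        have h2 : 0 ≤ (Ioc ((0 : ℝ) - 0) (0 + 0)).indicator (fun _ => (2 : ℝ)) x :=
          indicator_nonneg (fun _ _ => by norm_num) x
        exact (h1.trans (add_le_add le_rfl (add_le_add hP habs))).trans
          (le_add_of_nonneg_right h2))
    refine this.trans (ENNReal.ofReal_le_ofReal ?_)
    change R2 e ≤ _
    linarith

/-- For m ≥ 0 the bound α applies, for m ≤ -1 the bound 2π - α. -/
theorem le_abs_winding (α : ℝ) (m : ℤ) :
    min α (2 * Real.pi - α) ≤ |2 * Real.pi * m + α| := by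
  have hpi := Real.pi_pos
  rcases le_or_gt 0 m with h | h
  · have h' : (0 : ℝ) ≤ m := by exact_mod_cast h
    refine (min_le_left _ _).trans (le_trans ?_ (le_abs_self _))
    nlinarith
  · have h' : (m : ℝ) ≤ -1 := by exact_mod_cast Int.le_sub_one_of_lt h
    refine (min_le_right _ _).trans (le_trans ?_ (neg_le_abs _))
    nlinarith

/-- Above both thresholds, maps with the energy of a single vortex must nearly vanish. -/
theorem eventually_exists_norm_lt {L α : ℝ} {N : ℕ} (hL : 0 < L)
    (hα : α ∈ Ico (0 : ℝ) (2 * Real.pi)) (hα1 : 4 * Real.sqrt 2 / 3 < L * α ^ 2)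
    (hα2 : 4 * Real.sqrt 2 / 3 < L * (2 * Real.pi - α) ^ 2)
    {v : ℕ → ℝ → ℂ} {ε U : ℕ → ℝ} (hε : ∀ j, 0 < ε j) (hε0 : Tendsto ε atTop (𝓝 0))
    (hU : Tendsto U atTop (𝓝 (2 * Real.sqrt 2 / 3))) (hv : ∀ j, Admissible α (v j))
    (hE : ∀ j, energy L N (ε j) (v j) ≤ U j) {c : ℝ} (hc : 0 < c) :
    ∀ᶠ j in atTop, ∃ x ∈ Icc (0 : ℝ) 1, ‖v j x‖ < c := by
  set a₀ := min α (2 * Real.pi - α) with ha₀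
  have hs : 0 < Real.sqrt 2 := Real.sqrt_pos.2 (by norm_num)
  have ha₀sq : 4 * Real.sqrt 2 / 3 < L * a₀ ^ 2 := by
    rcases min_choice α (2 * Real.pi - α) with h | h <;> rw [ha₀, h] <;> assumption
  have ha₀0 : 0 < a₀ := by
    have h0 : 0 ≤ a₀ := le_min hα.1 (by linarith [hα.2])
    refine h0.lt_of_ne fun h => ?_
    rw [← h] at ha₀sq
    norm_num at ha₀sq
    linarith
  obtain ⟨M, hM⟩ : ∃ M, 2 * Real.sqrt 2 / 3 < M := exists_gt _
  set η : ℝ → ℝ := fun e => 1 / c ^ 2 * (Real.sqrt e * couplingConst L M N) with hη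
  have hη0 : Tendsto (fun j => η (ε j)) atTop (𝓝 0) := by
    have : Continuous η := by simp only [hη]; fun_prop
    have := (this.tendsto 0).comp hε0
    simpa [hη, Function.comp_def] using this
  -- In the limit this is the threshold hypothesis 2√2/3 < L a₀²/2. It contradicts the twist energy
  -- forced by any winding number if the modulus stays above c.
  have h1 : ∀ᶠ j in atTop, U j < L / 2 * (a₀ - η (ε j)) ^ 2 := by
    refine hU.eventually_lt (((hη0.const_sub a₀).pow 2).const_mul (L / 2)) ?_
    rw [sub_zero]
    linarith
  filter_upwards [h1, hη0.eventually_lt_const ha₀0, hU.eventually_lt_const hM] with j h1 h2 h3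
  by_contra! hcon
  have hu := hv j
  have hP := hu.1.integral_twist_mul_potential_le hL (hε j) ((hE j).trans h3.le)
  obtain ⟨k, hk⟩ := hu.exists_winding hc hcon
  have hP' : 1 / c ^ 2 * (∫ t in (0 : ℝ)..1, |twist (v j) t| * |‖v j t‖ ^ 2 - 1|) ≤ η (ε j) :=
    mul_le_mul_of_nonneg_left hP (by positivity)
  have hk' := hk.trans hP'
  set m := ∫ t in (0 : ℝ)..1, twist (v j) t
  have hw := le_abs_winding α (k - N)
  rw [← ha₀] at hw
  push_cast at hw
  have h4 : a₀ - η (ε j) ≤ |m - 2 * Real.pi * N| := by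
    have e : 2 * Real.pi * (k - N) + α = (m - 2 * Real.pi * N) - (m - (2 * Real.pi * k + α)) := by
      ring
    have := abs_sub (m - 2 * Real.pi * N) (m - (2 * Real.pi * k + α))
    rw [← e] at this
    linarith
  have h5 : (m - 2 * Real.pi * N) ^ 2 ≤ 2 * U j / L := by
    refine le_trans ?_ (hu.1.integral_twist_sub_sq_le hL (hε j) (hE j))
    have hTi := hu.1.intervalIntegrable_twist
    have := sq_integral_le (hTi.sub (intervalIntegrable_const (c := 2 * Real.pi * N)))
      (hu.1.intervalIntegrable_twist_sub_sq _)
    rw [intervalIntegral.integral_sub hTi intervalIntegrable_const] at this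
    simpa using this
  have h6 : (a₀ - η (ε j)) ^ 2 ≤ (m - 2 * Real.pi * N) ^ 2 := by
    rw [← sq_abs (m - 2 * Real.pi * N)]
    exact pow_le_pow_left₀ (by linarith) h4 2
  have h7 := h6.trans h5
  rw [le_div_iff₀ hL] at h7
  linarith

/-- With the energy of a single vortex the limit is a one-jump map. -/
theorem exists_tendsto_oneJump {L α : ℝ} {N : ℕ} (hL : 0 < L)
    {v : ℕ → ℝ → ℂ} {ε U : ℕ → ℝ} (hε : ∀ j, 0 < ε j) (hε0 : Tendsto ε atTop (𝓝 0))
    (hU : Tendsto U atTop (𝓝 (2 * Real.sqrt 2 / 3))) (hv : ∀ j, Admissible α (v j))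
    (hE : ∀ j, energy L N (ε j) (v j) ≤ U j)
    (hdip : ∀ c > 0, ∀ᶠ j in atTop, ∃ x ∈ Icc (0 : ℝ) 1, ‖v j x‖ < c) :
    ∃ φ : ℕ → ℕ, StrictMono φ ∧ ∃ x₀ ∈ Icc (0 : ℝ) 1,
      TendstoL2 (fun j => v (φ j)) (oneJump N α x₀) := by
  have hs : 0 < Real.sqrt 2 := Real.sqrt_pos.2 (by norm_num)
  have hs2 : Real.sqrt 2 * Real.sqrt 2 = 2 := Real.mul_self_sqrt (by norm_num)
  have hmin : ∀ j, ∃ x ∈ Icc (0 : ℝ) 1, ∀ y ∈ Icc (0 : ℝ) 1, ‖v j x‖ ≤ ‖v j y‖ := fun j => by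
    have hc := (hv j).1.continuousOn.norm
    rw [uIcc_of_le zero_le_one] at hc
    obtain ⟨x, hx, h⟩ := isCompact_Icc.exists_isMinOn (nonempty_Icc.2 zero_le_one) hc
    exact ⟨x, hx, fun y hy => isMinOn_iff.1 h y hy⟩
  choose x hx hxmin using hmin
  obtain ⟨x₀, hx₀, φ, hφ, hlim⟩ := isCompact_Icc.tendsto_subseq hx
  refine ⟨φ, hφ, x₀, hx₀, ?_⟩
  have hr : Tendsto (fun j => ‖v j (x j)‖) atTop (𝓝 0) := by
    refine tendsto_order.2 ⟨fun a ha => Eventually.of_forall fun j => ha.trans_le (norm_nonneg _),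
      fun a ha => ?_⟩
    filter_upwards [hdip a ha] with j hj
    obtain ⟨y, hy, hlt⟩ := hj
    exact (hxmin j y hy).trans_lt hlt
  obtain ⟨M, hM⟩ : ∃ M, 2 * Real.sqrt 2 / 3 < M := exists_gt _
  -- The energy left for the twist once the dip at x_j has been paid. It tends to 0 because the dip
  -- cost tends to 2√2/3, the limit of `U`.
  set D : ℕ → ℝ := fun j => 2 / L * (U j - (4 / 3 - 2 * ‖v j (x j)‖) * (Real.sqrt 2 / 2)) with hD
  have hD0 : Tendsto D atTop (𝓝 0) := by
    have := (hU.sub (((hr.const_mul 2).const_sub (4 / 3)).mul_const (Real.sqrt 2 / 2))).const_mul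
      (2 / L)
    convert this using 2
    ring
  have hTD : ∀ j, ∫ t in (0 : ℝ)..1, (twist (v j) t - 2 * Real.pi * N) ^ 2 ≤ D j := fun j => by
    have h1 := (hv j).1.one_dip_cost (hv j).norm_zero (hv j).norm_one (hx j)
    have h2 := h1.trans ((hv j).1.integral_potential_mul_deriv_le L N (hε j))
    set I := ∫ t in (0 : ℝ)..1, (twist (v j) t - 2 * Real.pi * N) ^ 2
    have h3 := mul_le_mul_of_nonneg_right h2 (by positivity : 0 ≤ Real.sqrt 2 / 2)
    have h4 : Real.sqrt 2 * (energy L N (ε j) (v j) - L / 2 * I) * (Real.sqrt 2 / 2) =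
        energy L N (ε j) (v j) - L / 2 * I := by
      linear_combination (energy L N (ε j) (v j) - L / 2 * I) / 2 * hs2
    have h5 : L / 2 * I ≤ U j - (4 / 3 - 2 * ‖v j (x j)‖) * (Real.sqrt 2 / 2) := by
      have := hE j
      linarith
    have h6 := mul_le_mul_of_nonneg_left h5 (by positivity : 0 ≤ 2 / L)
    have h7 : 2 / L * (L / 2 * I) = I := by field_simp
    rw [h7] at h6
    exact h6
  set B : ℕ → ℝ := fun j =>
    1 / (1 / 2) ^ 2 * (Real.sqrt (ε j) * couplingConst L M N) + Real.sqrt (D j) with hB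
  have hA0 : Tendsto (fun j => 3 * (4 * ε j * M) + 3 * B j ^ 2) atTop (𝓝 0) := by
    have hsq := Real.continuous_sqrt.tendsto (0 : ℝ)
    have h1 := (((hsq.comp hε0).mul_const (couplingConst L M N)).const_mul
      (1 / (1 / 2) ^ 2 : ℝ)).add (hsq.comp hD0)
    have h2 := (((hε0.const_mul 4).mul_const M).const_mul 3).add ((h1.pow 2).const_mul 3)
    simpa [hB] using h2
  have hkey : ∀ δ : ℝ, 0 < δ → ∀ᶠ j in atTop,
      eLpNorm (fun t => v (φ j) t - oneJump N α x₀ t) 2 (volume.restrict (Ioo (0 : ℝ) 1)) ≤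
        ENNReal.ofReal (Real.sqrt (49 * δ)) := by
    intro δ hδ
    have hRδ : Tendsto (fun j => 4 * ε j * M / δ) atTop (𝓝 0) := by
      simpa using ((hε0.const_mul 4).mul_const M).div_const δ
    -- The left side tends to 4/3 and the right side to 4/3 + 5/12, so a second dip at distance δ is
    -- unaffordable.
    have hc : ∀ᶠ j in atTop, Real.sqrt 2 * U j <
        4 / 3 + 5 / 12 - 2 * ‖v j (x j)‖ - 8 / 3 * (4 * ε j * M / δ) := by
      refine (hU.const_mul (Real.sqrt 2)).eventually_lt
        (((hr.const_mul 2).const_sub (4 / 3 + 5 / 12)).sub (hRδ.const_mul (8 / 3))) ?_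
      nlinarith
    have hall := ((hc.and (hRδ.eventually_lt_const zero_lt_one)).and
      ((hA0.eventually_lt_const hδ).and (hU.eventually_lt_const hM)))
    have hball : ∀ᶠ j in atTop, |x (φ j) - x₀| < δ := by
      have := Metric.tendsto_nhds.1 hlim δ hδ
      simpa [Real.dist_eq] using this
    filter_upwards [hφ.tendsto_atTop.eventually hall, hball] with j hj hjx
    set i := φ j
    obtain ⟨⟨h1, h2⟩, h3, h4⟩ := hj
    have hu := hv i
    have hEM := (hE i).trans h4.le
    have hpot := hu.1.integral_potential_sq_le hL (hε i) hEM
    have hlow : ∀ y ∈ Icc (0 : ℝ) 1, δ ≤ |y - x i| → 1 / 2 ≤ ‖v i y‖ := fun y hy hyx => by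
      refine hu.1.half_le_norm_of_dip hu.norm_zero hu.norm_one (hx i) hy hδ hyx hpot h2.le ?_
      refine lt_of_le_of_lt ?_ h1
      refine (hu.1.integral_potential_mul_deriv_le L N (hε i)).trans ?_
      refine mul_le_mul_of_nonneg_left ?_ hs.le
      have h5 : 0 ≤ L / 2 * ∫ t in (0 : ℝ)..1, (twist (v i) t - 2 * Real.pi * N) ^ 2 :=
        mul_nonneg (by positivity) (intervalIntegral.integral_nonneg zero_le_one
          fun _ _ => sq_nonneg _)
      have := hE i
      linarith
    have hBi : 1 / (1 / 2) ^ 2 * (∫ t in (0 : ℝ)..1, |twist (v i) t| * |‖v i t‖ ^ 2 - 1|)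
        + (∫ t in (0 : ℝ)..1, |twist (v i) t - 2 * Real.pi * N|) ≤ B i := by
      refine add_le_add (mul_le_mul_of_nonneg_left
        (hu.1.integral_twist_mul_potential_le hL (hε i) hEM) (by norm_num)) ?_
      refine Real.le_sqrt_of_sq_le (le_trans ?_ (hTD i))
      have h5 := sq_integral_le (hu.1.intervalIntegrable_abs_twist_sub (2 * Real.pi * N)) (by
        simp_rw [sq_abs]
        exact hu.1.intervalIntegrable_twist_sub_sq _)
      simpa only [sq_abs] using h5
    have hB0 : 0 ≤ B i := le_trans (add_nonneg (mul_nonneg (by norm_num)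
      (intervalIntegral.integral_nonneg zero_le_one fun _ _ => by positivity))
      (intervalIntegral.integral_nonneg zero_le_one fun _ _ => abs_nonneg _)) hBi
    have hjx' := abs_lt.1 hjx
    -- The window has radius 2δ since x_j is within δ of x₀: points outside it are at least δ from
    -- x_j. The bound is then δ + 24 · 2δ = 49δ.
    refine (hu.1.eLpNorm_sub_le (v := oneJump N α x₀) (B := B i) (x₀ := x₀) (δ := 2 * δ)
      (by positivity) hpot fun y hy => ?_).trans (ENNReal.ofReal_le_ofReal
        (Real.sqrt_le_sqrt (by linarith)))
    by_cases hyS : y ∈ Ioc (x₀ - 2 * δ) (x₀ + 2 * δ)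
    · rw [indicator_of_mem hyS]
      have h5 : ‖oneJump N α x₀ y‖ = 1 := by
        unfold oneJump
        split_ifs <;> exact Complex.norm_exp_I_mul_ofReal _
      have h6 := norm_sub_le (v i y) (oneJump N α x₀ y)
      have h7 := (le_abs_self _).trans (abs_sub_one_le_abs_sq_sub_one (norm_nonneg (v i y)))
      linarith
    · rw [indicator_of_notMem hyS, add_zero]
      rcases le_or_gt y (x₀ - 2 * δ) with h | h
      · have h5 := hu.norm_sub_constTwist_le (c := 1 / 2) (κ := 2 * Real.pi * N) (by norm_num)
          (Ioo_subset_Icc_self hy) (fun t ht => hlow t ⟨ht.1, ht.2.trans hy.2.le⟩ (by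
            rw [abs_of_nonpos (by linarith [ht.2])]
            linarith [ht.2]))
        have h6 : oneJump N α x₀ y = constTwist (2 * Real.pi * N) y := if_pos (by linarith)
        rw [h6]
        exact h5.trans (add_le_add le_rfl hBi)
      · have h' : x₀ + 2 * δ < y := by
          by_contra h''
          exact hyS ⟨h, not_lt.1 h''⟩
        have h5 := hu.norm_sub_constTwist_right_le (c := 1 / 2) N (by norm_num)
          (Ioo_subset_Icc_self hy) (fun t ht => hlow t ⟨hy.1.le.trans ht.1, ht.2⟩ (by
            rw [abs_of_nonneg (by linarith [ht.1])]
            linarith [ht.1]))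
        have h6 : oneJump N α x₀ y =
          Complex.exp (Complex.I * (2 * Real.pi * N * y + α : ℝ)) := if_neg (by linarith)
        rw [h6]
        exact h5.trans (add_le_add le_rfl hBi)
  refine ENNReal.tendsto_nhds_zero.2 fun e he => ?_
  have hlim0 : Tendsto (fun δ : ℝ => ENNReal.ofReal (Real.sqrt (49 * δ))) (𝓝[>] 0) (𝓝 0) := by
    have hc : Continuous fun δ : ℝ => ENNReal.ofReal (Real.sqrt (49 * δ)) :=
      ENNReal.continuous_ofReal.comp (by fun_prop)
    exact (hc.tendsto' 0 0 (by simp)).mono_left nhdsWithin_le_nhds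
  obtain ⟨δ, hδe, hδ⟩ := ((hlim0.eventually_le_const he).and self_mem_nhdsWithin).exists
  filter_upwards [hkey δ hδ] with j hj
  exact hj.trans hδe

theorem tendsto_jumpCompetitor_bound (L : ℝ) (N : ℕ) {ε : ℕ → ℝ} (hε : ∀ j, 0 < ε j)
    (hε0 : Tendsto ε atTop (𝓝 0)) :
    Tendsto (fun j => ε j / 2 * (2 * Real.pi * N) ^ 2 +
      (1 + 2 * L * ε j * (2 * Real.pi * N) ^ 2) * (2 * Real.sqrt 2 / 3) /
        Real.tanh (1 / (Real.sqrt 2 * ε j) / 2) ^ 2) atTop (𝓝 (2 * Real.sqrt 2 / 3)) := by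
  have hs : 0 < Real.sqrt 2 := Real.sqrt_pos.2 (by norm_num)
  have h1 : Tendsto (fun j => 1 / (Real.sqrt 2 * ε j) / 2) atTop atTop := by
    have h2 : Tendsto ε atTop (𝓝[>] 0) :=
      tendsto_nhdsWithin_iff.2 ⟨hε0, Eventually.of_forall hε⟩
    have h3 := (tendsto_inv_nhdsGT_zero.comp h2).const_mul_atTop
      (by positivity : 0 < 1 / (Real.sqrt 2 * 2))
    refine h3.congr fun j => ?_
    have := (hε j).ne'
    simp only [Function.comp]
    field_simp
  have h2 := (tendsto_tanh_atTop.comp h1).pow 2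
  have h3 := (((hε0.const_mul (2 * L)).mul_const ((2 * Real.pi * N) ^ 2)).const_add 1).mul_const
    (2 * Real.sqrt 2 / 3)
  have h4 := ((hε0.div_const 2).mul_const ((2 * Real.pi * N) ^ 2)).add
    (h3.div h2 (by norm_num))
  convert! h4 using 2
  ring

/-! ### Selection of the winding number and conclusion. -/

theorem tendstoL2_of_eventually_le {w : ℕ → ℝ → ℂ} {f : ℝ → ℂ} {R : ℕ → ℝ}
    (hR : Tendsto R atTop (𝓝 0)) (h : ∀ᶠ j in atTop,
      eLpNorm (fun x => w j x - f x) 2 (volume.restrict (Ioo (0 : ℝ) 1)) ≤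
        ENNReal.ofReal (R j)) : TendstoL2 w f := by
  refine tendsto_of_tendsto_of_tendsto_of_le_of_le' tendsto_const_nhds ?_
    (Eventually.of_forall fun _ => zero_le) h
  simpa using ENNReal.tendsto_ofReal hR

/-- Only the twists `2πN + α` and `2π(N-1) + α` can nearly minimise the elastic energy. -/
theorem winding_eq {α β ρ : ℝ} {m : ℤ} (h : |2 * Real.pi * m + α| ≤ β + ρ) (hβ1 : β ≤ α) (hβ2 : β ≤ 2 * Real.pi - α)
    (hρ : ρ < 2 * Real.pi) : m = 0 ∨ m = -1 := by
  have hpi := Real.pi_pos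
  obtain ⟨h1, h2⟩ := abs_le.1 h
  have hlt : (m : ℝ) < 1 := by
    by_contra! hm
    nlinarith
  have hgt : (-2 : ℝ) < m := by
    by_contra! hm
    nlinarith
  have hlt' : m < 1 := by exact_mod_cast hlt
  have hgt' : -2 < m := by exact_mod_cast hgt
  omega

theorem corollary3p6 (L : ℝ) (hL : 0 < L) (N : ℕ) (hN : 0 < N)
    (α : ℝ) (hα : α ∈ Ico (0 : ℝ) (2 * Real.pi))
    (u : ℝ → ℝ → ℂ) (hu : ∀ ε : ℝ, 0 < ε → IsGlobalMinimizer L N α ε (u ε))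
    (ε : ℕ → ℝ) (hε : ∀ j, 0 < ε j) (hε0 : Tendsto ε atTop (𝓝 0)) :
    -- the one-jump regime
    (4 * Real.sqrt 2 / 3 < L * α ^ 2 → 4 * Real.sqrt 2 / 3 < L * (2 * Real.pi - α) ^ 2 →
      ∃ φ : ℕ → ℕ, StrictMono φ ∧ ∃ x₀ ∈ Icc (0 : ℝ) 1,
        TendstoL2 (fun j => u (ε (φ j))) (oneJump N α x₀)) ∧
    -- no jump, twist `2πN + α`
    (L * α ^ 2 < 4 * Real.sqrt 2 / 3 → α < Real.pi →
      ∃ φ : ℕ → ℕ, StrictMono φ ∧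
        TendstoL2 (fun j => u (ε (φ j))) (constTwist (2 * Real.pi * N + α))) ∧
    -- no jump, twist `2π(N-1) + α`
    (L * (2 * Real.pi - α) ^ 2 < 4 * Real.sqrt 2 / 3 → Real.pi < α →
      ∃ φ : ℕ → ℕ, StrictMono φ ∧
        TendstoL2 (fun j => u (ε (φ j))) (constTwist (2 * Real.pi * ((N : ℝ) - 1) + α))) ∧
    -- the borderline `α = π` of the two no-jump regimes
    (L * α ^ 2 < 4 * Real.sqrt 2 / 3 → α = Real.pi →
      ∃ φ : ℕ → ℕ, StrictMono φ ∧
        (TendstoL2 (fun j => u (ε (φ j))) (constTwist (2 * Real.pi * N + α)) ∨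
          TendstoL2 (fun j => u (ε (φ j)))
            (constTwist (2 * Real.pi * ((N : ℝ) - 1) + α)))) := by
  have hpi := Real.pi_pos
  have hadm : ∀ j, Admissible α (u (ε j)) := fun j => (hu (ε j) (hε j)).1
  -- Comparison with the constant-twist map of winding k, for every integer k.
  have hbound : ∀ (k : ℤ) (j : ℕ), energy L N (ε j) (u (ε j)) ≤
      ε j * ((2 * Real.pi * k + α) ^ 2 / 2) + L / 2 * (2 * Real.pi * (k - N) + α) ^ 2 :=
    fun k j => by
      refine ((hu (ε j) (hε j)).2 _ (admissible_constTwist k rfl)).trans (le_of_eq ?_)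
      rw [energy_constTwist]
      ring
  refine ⟨fun h1 h2 => ?_, fun h1 h2 => ?_, fun h1 h2 => ?_, fun h1 h2 => ?_⟩
  · have hE : ∀ j, energy L N (ε j) (u (ε j)) ≤ _ := fun j =>
      ((hu (ε j) (hε j)).2 _ (admissible_jumpCompetitor N α
        (by have := hε j; positivity : 0 < 1 / (Real.sqrt 2 * ε j)))).trans
        (energy_jumpCompetitor_le hL N α (hε j))
    have hU := tendsto_jumpCompetitor_bound L N hε hε0
    exact exists_tendsto_oneJump (v := fun j => u (ε j)) hL hε hε0 hU hadm hE
      fun c hc => eventually_exists_norm_lt (v := fun j => u (ε j)) hL hα h1 h2 hε hε0 hU hadm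
        hE hc
  · obtain ⟨R, hR, hev⟩ := exists_close_constTwist (v := fun j => u (ε j)) (β := α) hL
      (by positivity : 0 ≤ (2 * Real.pi * (N : ℤ) + α) ^ 2 / 2) h1 hε hε0 hadm
      (fun j => by simpa using hbound N j)
    refine ⟨id, strictMono_id, tendstoL2_of_eventually_le hR ?_⟩
    -- 2π - 2α is the gap between the two candidate defects 2π - α and α; an error below it excludes
    -- k = N - 1. The whole sequence converges here.
    filter_upwards [hev, hR.eventually_lt_const (by linarith : 0 < 2 * Real.pi - 2 * α)]
      with j ⟨k, hk1, hk2⟩ hj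
    rw [abs_of_nonneg hα.1] at hk1 hk2
    have hk : k = N := by
      have := winding_eq (m := k - N) (ρ := R j) (by push_cast; exact hk1) le_rfl
        (by linarith) (by linarith [hα.1])
      rcases this with h | h
      · omega
      · exfalso
        have h' : (k : ℝ) - N = -1 := by exact_mod_cast h
        rw [h'] at hk1
        have := neg_le_abs (2 * Real.pi * -1 + α)
        linarith
    subst hk
    exact hk2 (by simp [abs_of_nonneg hα.1])
  · obtain ⟨R, hR, hev⟩ := exists_close_constTwist (v := fun j => u (ε j)) (β := 2 * Real.pi - α) hL
      (by positivity : 0 ≤ (2 * Real.pi * (N - 1 : ℤ) + α) ^ 2 / 2) h1 hε hε0 hadm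
      (fun j => by
        refine (hbound (N - 1) j).trans (le_of_eq ?_)
        push_cast
        ring)
    refine ⟨id, strictMono_id, tendstoL2_of_eventually_le hR ?_⟩
    filter_upwards [hev, hR.eventually_lt_const (by linarith : 0 < 2 * α - 2 * Real.pi)]
      with j ⟨k, hk1, hk2⟩ hj
    rw [abs_of_nonneg (by linarith [hα.2] : 0 ≤ 2 * Real.pi - α)] at hk1 hk2
    have hk : k = N - 1 := by
      have := winding_eq (m := k - N) (ρ := R j) (by push_cast; exact hk1)
        (by linarith) le_rfl (by linarith [hα.2])
      rcases this with h | h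
      · exfalso
        have h' : (k : ℝ) - N = 0 := by exact_mod_cast h
        rw [h'] at hk1
        have := le_abs_self (2 * Real.pi * 0 + α)
        linarith
      · omega
    subst hk
    have := hk2 (by
      push_cast
      rw [abs_of_nonpos (by linarith [hα.2])]
      ring)
    push_cast at this
    exact this
  · obtain ⟨R, hR, hev⟩ := exists_close_constTwist (v := fun j => u (ε j)) (β := α) hL
      (by positivity : 0 ≤ (2 * Real.pi * (N : ℤ) + α) ^ 2 / 2) h1 hε hε0 hadm
      (fun j => by simpa using hbound N j)
    have hev' : ∀ᶠ j in atTop,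
        (eLpNorm (fun x => u (ε j) x - constTwist (2 * Real.pi * N + α) x) 2
          (volume.restrict (Ioo (0 : ℝ) 1)) ≤ ENNReal.ofReal (R j)) ∨
        (eLpNorm (fun x => u (ε j) x - constTwist (2 * Real.pi * ((N : ℝ) - 1) + α) x) 2
          (volume.restrict (Ioo (0 : ℝ) 1)) ≤ ENNReal.ofReal (R j)) := by
      filter_upwards [hev, hR.eventually_lt_const (by linarith : 0 < 2 * Real.pi)]
        with j ⟨k, hk1, hk2⟩ hj
      rw [abs_of_nonneg hα.1] at hk1 hk2
      rcases winding_eq (m := k - N) (ρ := R j) (by push_cast; exact hk1) le_rfl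
        (by linarith) hj with h | h
      · left
        have hk : k = N := by omega
        subst hk
        exact hk2 (by simp [abs_of_nonneg hα.1])
      · right
        have hk : k = N - 1 := by omega
        subst hk
        have := hk2 (by
          push_cast
          rw [abs_of_nonpos (by linarith [hα.2])]
          linarith)
        push_cast at this
        exact this
    -- At α = π both windings have the same limiting cost, so the choice may vary with j; one of
    -- them occurs infinitely often.
    rcases frequently_or_distrib.1 hev'.frequently with h | h
    · obtain ⟨φ, hφ, hj⟩ := extraction_of_frequently_atTop h
      exact ⟨φ, hφ, Or.inl (tendstoL2_of_eventually_le (hR.comp hφ.tendsto_atTop)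
        (Eventually.of_forall hj))⟩
    · obtain ⟨φ, hφ, hj⟩ := extraction_of_frequently_atTop h
      exact ⟨φ, hφ, Or.inr (tendstoL2_of_eventually_le (hR.comp hφ.tendsto_atTop)
        (Eventually.of_forall hj))⟩
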